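/- Let $\beta,\gamma\in\mathbb C\setminus\{0\}$, let $U\subseteq\mathbb C^4$ be open with coordinates $z^1,\dots,z^4$ (subscripts denote partial derivatives, $\partial_i=\partial/\partial z^i$), and let $u$ be a holomorphic function on $U$ satisfying $$(\beta+\gamma)u_{12}u_{34}=\beta u_{13}u_{24}+\gamma u_{14}u_{23},$$ with $u_{34}$ and $\Delta=u_{13}u_{24}-u_{14}u_{23}$ nowhere zero on $U$. Define $$ds^2=\frac{2(\beta+\gamma)}{\Delta}\Big\{u_{12}\big[u_{13}u_{14}(dz^1)^2+u_{23}u_{24}(dz^2)^2\big]+u_{34}\big[u_{13}u_{23}(dz^3)^2+u_{14}u_{24}(dz^4)^2\big]$$ $$+(u_{13}u_{24}+u_{14}u_{23})(u_{12}dz^1dz^2+u_{34}dz^3dz^4)+(u_{12}u_{34}+u_{14}u_{23})(u_{13}dz^1dz^3+u_{24}dz^2dz^4)$$ $$+(u_{12}u_{34}+u_{13}u_{24})(u_{23}dz^2dz^3+u_{14}dz^1dz^4)\Big\}.$$ (a) $ds^2$ is a (nondegenerate) holomorphic metric $g$ on $U$, $-\beta\gamma\Delta\,dz^1\wedge dz^2\wedge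 dz^3\wedge dz^4$ is a volume form of it (its coefficient squares to $\det(g_{ij})$), $g$ is Ricci-flat, and $g$ is anti-self-dual for the orientation given by this volume form: the Weyl tensor $C$ satisfies $\star C=-C$, where $\star$ is the Hodge star on 2-forms. (b) Every point of $U$ has an open neighbourhood $V\subseteq U$ carrying a holomorphic function $s$ with $s^2=u_{34}\Delta$. For every open $V\subseteq U$, every such $s=\sqrt{u_{34}\Delta}$ on $V$, and every choice of the constants $\sqrt\beta,\sqrt\gamma$ (all other roots below being expressed through these three), the holomorphic vector fields $$W=\frac{u_{34}\partial_1-u_{13}\partial_4}{\sqrt{\beta\gamma u_{34}\Delta}},\quad Z=\frac{u_{23}\partial_4-u_{34}\partial_2}{\sqrt{\beta\gamma u_{34}\Delta}},\quad \tilde W=\frac{\sqrt\beta\,(u_{24}\partial_3-u_{34}\partial_2)}{\sqrt{\gamma u_{34}\Delta}},\quad \tilde Z=\frac{\sqrt\gamma\,(u_{14}\partial_3-u_{34}\partial_1)}{\sqrt{\beta u_{34}\Delta}}$$ form a null tetrad of $g$ on $V$, i.e. $g(Z,\tilde Z)=1$, $g(W,\tilde W)=-1$ and all other inner products among them vanish;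 the volume form in (a) takes the value $1$ on $(W,\tilde W,Z,\tilde Z)$. The dual coframe, i.e. the 1-forms with $\omega^1(W)=\omega^2(Z)=\omega^3(\tilde W)=\omega^4(\tilde Z)=1$ and all other pairings zero, is $$\omega^1=-\sqrt{\tfrac{\beta\gamma}{u_{34}\Delta}}\{u_{23}(u_{14}dz^1+u_{24}dz^2)+u_{34}(u_{23}dz^3+u_{24}dz^4)\},$$ $$\omega^2=-\sqrt{\tfrac{\beta\gamma}{u_{34}\Delta}}\{u_{13}(u_{14}dz^1+u_{24}dz^2)+u_{34}(u_{13}dz^3+u_{14}dz^4)\},$$ $$\omega^3=\sqrt{\tfrac{\gamma}{\beta u_{34}\Delta}}\{u_{14}(u_{13}dz^1+u_{23}dz^2)+u_{34}(u_{13}dz^3+u_{14}dz^4)\},$$ $$\omega^4=-\sqrt{\tfrac{\beta}{\gamma u_{34}\Delta}}\{u_{24}(u_{13}dz^1+u_{23}dz^2)+u_{34}(u_{23}dz^3+u_{24}dz^4)\},$$ and $ds^2=2(\omega^2\omega^4-\omega^1\omega^3)$. -/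

import Mathlib

open scoped Matrix

noncomputable section

namespace Heavenly

/-- Coordinate space with holomorphic coordinates `z¹, z², z³, z⁴`; the coordinate `zⁱ` has
index `i - 1 : Fin 4`. -/
abbrev C4 : Type := Fin 4 → ℂ

/-- The coordinate vector `∂/∂zⁱ`. -/
def basisVec (i : Fin 4) : C4 := Pi.single i 1

/-- The complex partial derivative `∂f/∂zⁱ`. -/
def pd (i : Fin 4) (f : C4 → ℂ) (z : C4) : ℂ := fderiv ℂ f z (basisVec i)

/-- The second partial derivative `∂²u/∂zⁱ∂zʲ` (so `u₁₂ = d2 u 0 1`, and so on). -/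
def d2 (u : C4 → ℂ) (i j : Fin 4) (z : C4) : ℂ := pd j (pd i u) z

/-! ### Holomorphic metrics and their curvature -/

/-- The bilinear form `g(v, w)` at `z` of a tensor with component matrix `gᵢⱼ`. -/
def inner2 (g : C4 → Matrix (Fin 4) (Fin 4) ℂ) (z : C4) (v w : C4) : ℂ := v ⬝ᵥ (g z *ᵥ w)

/-- `g` is the component matrix of a holomorphic metric on `U`: holomorphic components,
symmetric and nondegenerate. -/
structure IsHolomorphicMetric (g : C4 → Matrix (Fin 4) (Fin 4) ℂ) (U : Set C4) : Prop where
  analytic : ∀ i j, AnalyticOnNhd ℂ (fun z => g z i j) U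
  symm : ∀ z ∈ U, (g z).IsSymm
  nondegenerate : ∀ z ∈ U, (g z).det ≠ 0

/-- Christoffel symbols `Γᵏᵢⱼ` of the Levi-Civita connection. -/
def christoffel (g : C4 → Matrix (Fin 4) (Fin 4) ℂ) (k i j : Fin 4) (z : C4) : ℂ :=
  (1 / 2) * ∑ l, (g z)⁻¹ k l *
    (pd i (fun w => g w l j) z + pd j (fun w => g w l i) z - pd l (fun w => g w i j) z)

/-- Riemann tensor `Rᵏₗᵢⱼ = ∂ᵢΓᵏⱼₗ - ∂ⱼΓᵏᵢₗ + ΓᵏᵢₘΓᵐⱼₗ - ΓᵏⱼₘΓᵐᵢₗ`. -/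
def riemann (g : C4 → Matrix (Fin 4) (Fin 4) ℂ) (k l i j : Fin 4) (z : C4) : ℂ :=
  pd i (christoffel g k j l) z - pd j (christoffel g k i l) z
    + ∑ m, (christoffel g k i m z * christoffel g m j l z
        - christoffel g k j m z * christoffel g m i l z)

/-- Riemann tensor with all indices lowered, `Rₖₗᵢⱼ = gₖₘ Rᵐₗᵢⱼ`. -/
def riemannLow (g : C4 → Matrix (Fin 4) (Fin 4) ℂ) (k l i j : Fin 4) (z : C4) : ℂ :=
  ∑ m, g z k m * riemann g m l i j z

/-- Ricci tensor `Rₗⱼ = Rᵏₗₖⱼ`. -/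
def ricci (g : C4 → Matrix (Fin 4) (Fin 4) ℂ) (l j : Fin 4) (z : C4) : ℂ :=
  ∑ k, riemann g k l k j z

/-- Scalar curvature. -/
def scalarCurv (g : C4 → Matrix (Fin 4) (Fin 4) ℂ) (z : C4) : ℂ :=
  ∑ l, ∑ j, (g z)⁻¹ l j * ricci g l j z

/-- Weyl conformal curvature tensor `Cₖₗᵢⱼ` in dimension four. -/
def weyl (g : C4 → Matrix (Fin 4) (Fin 4) ℂ) (k l i j : Fin 4) (z : C4) : ℂ :=
  riemannLow g k l i j z
    - (1 / 2) * (g z k i * ricci g l j z - g z k j * ricci g l i z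
        - g z l i * ricci g k j z + g z l j * ricci g k i z)
    + (1 / 6) * scalarCurv g z * (g z k i * g z l j - g z k j * g z l i)

/-- Vanishing of the Ricci tensor on `U`. -/
def IsRicciFlat (g : C4 → Matrix (Fin 4) (Fin 4) ℂ) (U : Set C4) : Prop :=
  ∀ z ∈ U, ∀ i j, ricci g i j z = 0

/-- The value on `(a, b, c, d)` of the 4-form `ρ dz¹ ∧ dz² ∧ dz³ ∧ dz⁴` (with
`dz¹ ∧ dz² ∧ dz³ ∧ dz⁴ (∂₁, ∂₂, ∂₃, ∂₄) = 1`). -/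
def fourForm (ρ : C4 → ℂ) (z : C4) (a b c d : C4) : ℂ :=
  ρ z * Matrix.det (Matrix.of ![a, b, c, d])

/-- `ρ dz¹ ∧ dz² ∧ dz³ ∧ dz⁴` is a metric volume form of `g` on `U`. Choosing one of the two
holomorphic roots `ρ` of `det g` is the choice of an orientation. -/
structure IsMetricVolume (g : C4 → Matrix (Fin 4) (Fin 4) ℂ) (ρ : C4 → ℂ) (U : Set C4) :
    Prop where
  analytic : AnalyticOnNhd ℂ ρ U
  sq_eq : ∀ z ∈ U, ρ z ^ 2 = (g z).det

/-- The Hodge dual `(⋆F)(∂ᵢ, ∂ⱼ) = ½ ε(∂ᵢ, ∂ⱼ, ∂ₐ, ∂_b) gᵃᵐ gᵇⁿ Fₘₙ` of a 2-form, where `ε` is the volume form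
`ρ dz¹ ∧ dz² ∧ dz³ ∧ dz⁴`. -/
def hodgeStar (g : C4 → Matrix (Fin 4) (Fin 4) ℂ) (ρ : C4 → ℂ) (z : C4)
    (F : Fin 4 → Fin 4 → ℂ) (i j : Fin 4) : ℂ :=
  (1 / 2) * ∑ a, ∑ b, ∑ m, ∑ n,
    fourForm ρ z (basisVec i) (basisVec j) (basisVec a) (basisVec b) *
      (g z)⁻¹ a m * (g z)⁻¹ b n * F m n

/-- The metric `g` is anti-self-dual on `U` for the orientation given by the volume form
`ρ dz¹ ∧ dz² ∧ dz³ ∧ dz⁴`: its Weyl tensor satisfies `⋆C = -C`. -/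
def IsAntiSelfDual (g : C4 → Matrix (Fin 4) (Fin 4) ℂ) (ρ : C4 → ℂ) (U : Set C4) : Prop :=
  ∀ z ∈ U, ∀ i j k l,
    hodgeStar g ρ z (fun m n => weyl g m n k l z) i j = -weyl g i j k l z

/-- `(W, Z, W', Z')` is a null tetrad of `g` on `U` (with `W'`, `Z'` standing for `W̃`, `Z̃`):
the only nonzero inner products are `g(Z, Z̃) = 1` and `g(W, W̃) = -1`. -/
structure IsNullTetrad (g : C4 → Matrix (Fin 4) (Fin 4) ℂ) (W Z W' Z' : C4 → C4)
    (U : Set C4) : Prop where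
  analytic_W : AnalyticOnNhd ℂ W U
  analytic_Z : AnalyticOnNhd ℂ Z U
  analytic_W' : AnalyticOnNhd ℂ W' U
  analytic_Z' : AnalyticOnNhd ℂ Z' U
  WW : ∀ z ∈ U, inner2 g z (W z) (W z) = 0
  ZZ : ∀ z ∈ U, inner2 g z (Z z) (Z z) = 0
  W'W' : ∀ z ∈ U, inner2 g z (W' z) (W' z) = 0
  Z'Z' : ∀ z ∈ U, inner2 g z (Z' z) (Z' z) = 0
  WZ : ∀ z ∈ U, inner2 g z (W z) (Z z) = 0
  WZ' : ∀ z ∈ U, inner2 g z (W z) (Z' z) = 0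
  W'Z : ∀ z ∈ U, inner2 g z (W' z) (Z z) = 0
  W'Z' : ∀ z ∈ U, inner2 g z (W' z) (Z' z) = 0
  WW' : ∀ z ∈ U, inner2 g z (W z) (W' z) = -1
  ZZ' : ∀ z ∈ U, inner2 g z (Z z) (Z' z) = 1

/-! ### The general heavenly equation, its tetrad, coframe and metric -/

/-- `(β + γ) u₁₂ u₃₄ = β u₁₃ u₂₄ + γ u₁₄ u₂₃` on `U`. -/
def SolvesGeneralHeavenly (β γ : ℂ) (u : C4 → ℂ) (U : Set C4) : Prop :=
  ∀ z ∈ U, (β + γ) * d2 u 0 1 z * d2 u 2 3 z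
    = β * d2 u 0 2 z * d2 u 1 3 z + γ * d2 u 0 3 z * d2 u 1 2 z

/-- `Δ = u₁₃ u₂₄ - u₁₄ u₂₃`. -/
def Delta (u : C4 → ℂ) (z : C4) : ℂ :=
  d2 u 0 2 z * d2 u 1 3 z - d2 u 0 3 z * d2 u 1 2 z

/- In the following definitions `b = √β`, `c = √γ` and `s = √(u₃₄ Δ)`. -/

/-- `W = (u₃₄ ∂₁ - u₁₃ ∂₄) / √(β γ u₃₄ Δ)`. -/
def fieldW (b c : ℂ) (s u : C4 → ℂ) (z : C4) : C4 :=
  (1 / (b * c * s z)) • (d2 u 2 3 z • basisVec 0 - d2 u 0 2 z • basisVec 3)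

/-- `Z = (u₂₃ ∂₄ - u₃₄ ∂₂) / √(β γ u₃₄ Δ)`. -/
def fieldZ (b c : ℂ) (s u : C4 → ℂ) (z : C4) : C4 :=
  (1 / (b * c * s z)) • (d2 u 1 2 z • basisVec 3 - d2 u 2 3 z • basisVec 1)

/-- `W̃ = √β (u₂₄ ∂₃ - u₃₄ ∂₂) / √(γ u₃₄ Δ)`. -/
def fieldW' (b c : ℂ) (s u : C4 → ℂ) (z : C4) : C4 :=
  (b / (c * s z)) • (d2 u 1 3 z • basisVec 2 - d2 u 2 3 z • basisVec 1)

/-- `Z̃ = √γ (u₁₄ ∂₃ - u₃₄ ∂₁) / √(β u₃₄ Δ)`. -/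
def fieldZ' (b c : ℂ) (s u : C4 → ℂ) (z : C4) : C4 :=
  (c / (b * s z)) • (d2 u 0 3 z • basisVec 2 - d2 u 2 3 z • basisVec 0)

/-- The tetrad `(W, Z, W̃, Z̃)`, in this order. -/
def tetrad (b c : ℂ) (s u : C4 → ℂ) (z : C4) : Fin 4 → C4 :=
  ![fieldW b c s u z, fieldZ b c s u z, fieldW' b c s u z, fieldZ' b c s u z]

/-- `ω¹ = -√(βγ/(u₃₄Δ)) {u₂₃ (u₁₄ dz¹ + u₂₄ dz²) + u₃₄ (u₂₃ dz³ + u₂₄ dz⁴)}`, as a function of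
the point and of the tangent vector `v`. -/
def omega1 (b c : ℂ) (s u : C4 → ℂ) (z v : C4) : ℂ :=
  -(b * c / s z) * (d2 u 1 2 z * (d2 u 0 3 z * v 0 + d2 u 1 3 z * v 1)
    + d2 u 2 3 z * (d2 u 1 2 z * v 2 + d2 u 1 3 z * v 3))

/-- `ω² = -√(βγ/(u₃₄Δ)) {u₁₃ (u₁₄ dz¹ + u₂₄ dz²) + u₃₄ (u₁₃ dz³ + u₁₄ dz⁴)}`. -/
def omega2 (b c : ℂ) (s u : C4 → ℂ) (z v : C4) : ℂ :=
  -(b * c / s z) * (d2 u 0 2 z * (d2 u 0 3 z * v 0 + d2 u 1 3 z * v 1)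
    + d2 u 2 3 z * (d2 u 0 2 z * v 2 + d2 u 0 3 z * v 3))

/-- `ω³ = √(γ/(βu₃₄Δ)) {u₁₄ (u₁₃ dz¹ + u₂₃ dz²) + u₃₄ (u₁₃ dz³ + u₁₄ dz⁴)}`. -/
def omega3 (b c : ℂ) (s u : C4 → ℂ) (z v : C4) : ℂ :=
  (c / (b * s z)) * (d2 u 0 3 z * (d2 u 0 2 z * v 0 + d2 u 1 2 z * v 1)
    + d2 u 2 3 z * (d2 u 0 2 z * v 2 + d2 u 0 3 z * v 3))

/-- `ω⁴ = -√(β/(γu₃₄Δ)) {u₂₄ (u₁₃ dz¹ + u₂₃ dz²) + u₃₄ (u₂₃ dz³ + u₂₄ dz⁴)}`. -/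
def omega4 (b c : ℂ) (s u : C4 → ℂ) (z v : C4) : ℂ :=
  -(b / (c * s z)) * (d2 u 1 3 z * (d2 u 0 2 z * v 0 + d2 u 1 2 z * v 1)
    + d2 u 2 3 z * (d2 u 1 2 z * v 2 + d2 u 1 3 z * v 3))

/-- The coframe `(ω¹, ω², ω³, ω⁴)` evaluated on a tangent vector `v`. -/
def coframe (b c : ℂ) (s u : C4 → ℂ) (z v : C4) : Fin 4 → ℂ :=
  ![omega1 b c s u z v, omega2 b c s u z v, omega3 b c s u z v, omega4 b c s u z v]

/-- The line element `ds²` of the general heavenly equation, evaluated on the tangent vector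
`v = (dz¹, dz², dz³, dz⁴)`. -/
def lineElement (β γ : ℂ) (u : C4 → ℂ) (z v : C4) : ℂ :=
  2 * (β + γ) / Delta u z *
    (d2 u 0 1 z * (d2 u 0 2 z * d2 u 0 3 z * v 0 ^ 2 + d2 u 1 2 z * d2 u 1 3 z * v 1 ^ 2)
    + d2 u 2 3 z * (d2 u 0 2 z * d2 u 1 2 z * v 2 ^ 2 + d2 u 0 3 z * d2 u 1 3 z * v 3 ^ 2)
    + (d2 u 0 2 z * d2 u 1 3 z + d2 u 0 3 z * d2 u 1 2 z)
        * (d2 u 0 1 z * v 0 * v 1 + d2 u 2 3 z * v 2 * v 3)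
    + (d2 u 0 1 z * d2 u 2 3 z + d2 u 0 3 z * d2 u 1 2 z)
        * (d2 u 0 2 z * v 0 * v 2 + d2 u 1 3 z * v 1 * v 3)
    + (d2 u 0 1 z * d2 u 2 3 z + d2 u 0 2 z * d2 u 1 3 z)
        * (d2 u 1 2 z * v 1 * v 2 + d2 u 0 3 z * v 0 * v 3))

/-- The symmetric component matrix `gᵢⱼ` of `ds² = ∑ gᵢⱼ dzⁱ dzʲ`. -/
def metric (β γ : ℂ) (u : C4 → ℂ) (z : C4) : Matrix (Fin 4) (Fin 4) ℂ :=
  ((β + γ) / Delta u z) •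
    !![2 * (d2 u 0 1 z * d2 u 0 2 z * d2 u 0 3 z),
       d2 u 0 1 z * (d2 u 0 2 z * d2 u 1 3 z + d2 u 0 3 z * d2 u 1 2 z),
       d2 u 0 2 z * (d2 u 0 1 z * d2 u 2 3 z + d2 u 0 3 z * d2 u 1 2 z),
       d2 u 0 3 z * (d2 u 0 1 z * d2 u 2 3 z + d2 u 0 2 z * d2 u 1 3 z);
       d2 u 0 1 z * (d2 u 0 2 z * d2 u 1 3 z + d2 u 0 3 z * d2 u 1 2 z),
       2 * (d2 u 0 1 z * d2 u 1 2 z * d2 u 1 3 z),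
       d2 u 1 2 z * (d2 u 0 1 z * d2 u 2 3 z + d2 u 0 2 z * d2 u 1 3 z),
       d2 u 1 3 z * (d2 u 0 1 z * d2 u 2 3 z + d2 u 0 3 z * d2 u 1 2 z);
       d2 u 0 2 z * (d2 u 0 1 z * d2 u 2 3 z + d2 u 0 3 z * d2 u 1 2 z),
       d2 u 1 2 z * (d2 u 0 1 z * d2 u 2 3 z + d2 u 0 2 z * d2 u 1 3 z),
       2 * (d2 u 2 3 z * d2 u 0 2 z * d2 u 1 2 z),
       d2 u 2 3 z * (d2 u 0 2 z * d2 u 1 3 z + d2 u 0 3 z * d2 u 1 2 z);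
       d2 u 0 3 z * (d2 u 0 1 z * d2 u 2 3 z + d2 u 0 2 z * d2 u 1 3 z),
       d2 u 1 3 z * (d2 u 0 1 z * d2 u 2 3 z + d2 u 0 3 z * d2 u 1 2 z),
       d2 u 2 3 z * (d2 u 0 2 z * d2 u 1 3 z + d2 u 0 3 z * d2 u 1 2 z),
       2 * (d2 u 2 3 z * d2 u 0 3 z * d2 u 1 3 z)]

/-- The quadratic form of the component matrix is the line element. -/
theorem inner2_metric_self (β γ : ℂ) (u : C4 → ℂ) (z v : C4) :
    inner2 (metric β γ u) z v v = lineElement β γ u z v := by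
  simp [inner2, metric, lineElement, dotProduct, Matrix.mulVec, Fin.sum_univ_four,
    Matrix.smul_apply]
  ring

end Heavenly

end

open Heavenly

/-!
Why the theorem holds. Write `uᵢ = ∂u/∂zⁱ`. The four 2-forms `dzⁱ ∧ duᵢ` are closed, being
`-d(uᵢ dzⁱ)`, and they are defined by `u` alone. In the tetrad `(W, Z, W̃, Z̃)` the forms
with `i = 3` and `i = 4` are constant multiples of `ω³ ∧ ω⁴` and `ω¹ ∧ ω²`, and the general heavenly
equation says precisely that the form with `i = 1` has constant components as well, so that
`ω¹ ∧ ω³ - ω² ∧ ω⁴` is also a constant combination of closed forms (`coframeMat_sdForm`). Hence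
the whole space of self-dual 2-forms has a basis that is closed and has constant components in
a null coframe: the tetrad is a complex hyperkähler frame (`IsHyperkahlerFrame`,
`isHyperkahlerFrame`).

For such a frame the Levi-Civita connection makes the three 2-forms parallel. The metric
connection acts on self-dual forms through three 1-forms, and closedness is a linear system of
twelve equations for their twelve components with only the zero solution
(`parallel_of_closed`, `IsHyperkahlerFrame.parallel`). The integrability condition of parallelism
(`curvMat_of_parallel`) puts every curvature endomorphism into the stabiliser of the self-dual
forms, that is, makes it anti-self-dual (`exists_eq_asdForm`, `IsHyperkahlerFrame.curvMat_asd`).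
With the first Bianchi identity this kills the Ricci tensor (`sum_eq_zero_of_bianchi`,
`IsHyperkahlerFrame.ricci_eq_zero`), so the Weyl tensor is the Riemann tensor and is
anti-self-dual (`IsHyperkahlerFrame.hodgeStar_weyl`). These conclusions are local, so a
square root of `u₃₄ Δ` near each point suffices for them (`exists_local_sqrt`). The
statements on tetrad and coframe amount to `F E = 1` and `g = Fᵀ η F` for the matrices of the
coframe and the tetrad (`coframeMat_mul_tetradMat`, `coframeMat_gram`).
-/

open Heavenly

namespace Heavenly

open Filter Topology

/-! ### Partial derivatives -/

section PartialDerivatives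

variable {f h : C4 → ℂ} {z : C4}

theorem pd_congr {i : Fin 4} (hfh : f =ᶠ[𝓝 z] h) : pd i f z = pd i h z := by
  simp only [pd, hfh.fderiv_eq]

theorem pd_const (i : Fin 4) (a : ℂ) : pd i (fun _ => a) z = 0 := by
  simp [pd]

theorem pd_add (i : Fin 4) (hf : DifferentiableAt ℂ f z) (hh : DifferentiableAt ℂ h z) :
    pd i (fun w => f w + h w) z = pd i f z + pd i h z := by
  simp only [pd, fderiv_fun_add hf hh, add_apply]

theorem pd_sub (i : Fin 4) (hf : DifferentiableAt ℂ f z) (hh : DifferentiableAt ℂ h z) :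
    pd i (fun w => f w - h w) z = pd i f z - pd i h z := by
  simp only [pd, fderiv_fun_sub hf hh, sub_apply]

theorem pd_mul (i : Fin 4) (hf : DifferentiableAt ℂ f z) (hh : DifferentiableAt ℂ h z) :
    pd i (fun w => f w * h w) z = pd i f z * h z + f z * pd i h z := by
  simp only [pd, fderiv_fun_mul hf hh, add_apply,
    smul_apply, smul_eq_mul]
  ring

theorem pd_const_mul (i : Fin 4) (a : ℂ) (hf : DifferentiableAt ℂ f z) :
    pd i (fun w => a * f w) z = a * pd i f z := by
  simp only [pd, fderiv_const_mul hf, smul_apply, smul_eq_mul]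

theorem pd_sum {ι : Type*} (s : Finset ι) (i : Fin 4) {f : ι → C4 → ℂ}
    (hf : ∀ a ∈ s, DifferentiableAt ℂ (f a) z) :
    pd i (fun w => ∑ a ∈ s, f a w) z = ∑ a ∈ s, pd i (f a) z := by
  simp only [pd, fderiv_fun_sum hf, sum_apply]

theorem analyticAt_pd (i : Fin 4) (hf : AnalyticAt ℂ f z) : AnalyticAt ℂ (pd i f) z :=
  (ContinuousLinearMap.apply ℂ ℂ (basisVec i)).analyticAt _ |>.comp hf.fderiv

theorem pd_comm (i j : Fin 4) (hf : AnalyticAt ℂ f z) : pd i (pd j f) z = pd j (pd i f) z := by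
  have hsymm : IsSymmSndFDerivAt ℂ f z := (hf.contDiffAt (n := 2)).isSymmSndFDerivAt (by simp)
  have key : ∀ k l : Fin 4, pd k (pd l f) z
      = fderiv ℂ (fderiv ℂ f) z (basisVec k) (basisVec l) := by
    intro k l
    have hd : DifferentiableAt ℂ (fderiv ℂ f) z := hf.fderiv.differentiableAt
    change fderiv ℂ (fun w => fderiv ℂ f w (basisVec l)) z (basisVec k) = _
    rw [fderiv_clm_apply hd (differentiableAt_const _)]
    simp
  rw [key, key]
  exact hsymm _ _

end PartialDerivatives

/-- The entrywise partial derivative of a matrix-valued function. -/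
noncomputable def pdMat (k : Fin 4) (X : C4 → Matrix (Fin 4) (Fin 4) ℂ) (z : C4) :
    Matrix (Fin 4) (Fin 4) ℂ :=
  Matrix.of fun i j => pd k (fun w => X w i j) z

section MatrixDerivatives

variable {X Y : C4 → Matrix (Fin 4) (Fin 4) ℂ} {z : C4}

theorem pdMat_congr {k : Fin 4} (hXY : X =ᶠ[𝓝 z] Y) : pdMat k X z = pdMat k Y z := by
  ext i j
  exact pd_congr (hXY.mono fun w hw => by simp only [hw])

theorem pdMat_transpose (k : Fin 4) : pdMat k (fun w => (X w)ᵀ) z = (pdMat k X z)ᵀ := rfl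

theorem pdMat_const (k : Fin 4) (S : Matrix (Fin 4) (Fin 4) ℂ) :
    pdMat k (fun _ => S) z = 0 := by
  ext i j
  simp [pdMat, pd_const]

theorem pdMat_add (k : Fin 4) (hX : ∀ i j, DifferentiableAt ℂ (fun w => X w i j) z)
    (hY : ∀ i j, DifferentiableAt ℂ (fun w => Y w i j) z) :
    pdMat k (fun w => X w + Y w) z = pdMat k X z + pdMat k Y z := by
  ext i j
  exact pd_add k (hX i j) (hY i j)

theorem differentiableAt_matrix_mul (hX : ∀ i j, DifferentiableAt ℂ (fun w => X w i j) z)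
    (hY : ∀ i j, DifferentiableAt ℂ (fun w => Y w i j) z) (i j : Fin 4) :
    DifferentiableAt ℂ (fun w => (X w * Y w) i j) z := by
  simp only [Matrix.mul_apply]
  exact DifferentiableAt.fun_sum fun m _ => (hX i m).mul (hY m j)

theorem analyticAt_matrix_mul (hX : ∀ i j, AnalyticAt ℂ (fun w => X w i j) z)
    (hY : ∀ i j, AnalyticAt ℂ (fun w => Y w i j) z) (i j : Fin 4) :
    AnalyticAt ℂ (fun w => (X w * Y w) i j) z := by
  simp only [Matrix.mul_apply]
  exact Finset.analyticAt_fun_sum _ fun m _ => (hX i m).mul (hY m j)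

theorem pdMat_mul (k : Fin 4) (hX : ∀ i j, DifferentiableAt ℂ (fun w => X w i j) z)
    (hY : ∀ i j, DifferentiableAt ℂ (fun w => Y w i j) z) :
    pdMat k (fun w => X w * Y w) z = pdMat k X z * Y z + X z * pdMat k Y z := by
  ext i j
  simp only [pdMat, Matrix.of_apply, Matrix.add_apply, Matrix.mul_apply]
  refine (pd_sum Finset.univ k fun m _ => (hX i m).fun_mul (hY m j)).trans ?_
  rw [← Finset.sum_add_distrib]
  exact Finset.sum_congr rfl fun m _ => pd_mul k (hX i m) (hY m j)

theorem pdMat_comm (k l : Fin 4) (hX : ∀ i j, AnalyticAt ℂ (fun w => X w i j) z) :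
    pdMat k (pdMat l X) z = pdMat l (pdMat k X) z := by
  ext i j
  exact pd_comm k l (hX i j)

end MatrixDerivatives

/-! ### The Levi-Civita connection in matrix form -/

/-- The connection matrix `Γₖ` with entries `(Γₖ)ᵐᵢ = Γᵐₖᵢ`. -/
noncomputable def connMat (g : C4 → Matrix (Fin 4) (Fin 4) ℂ) (k : Fin 4) (z : C4) :
    Matrix (Fin 4) (Fin 4) ℂ :=
  Matrix.of fun m i => christoffel g m k i z

/-- The curvature matrix `Rᵢⱼ` with entries `(Rᵢⱼ)ᵏₗ = Rᵏₗᵢⱼ`. -/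
noncomputable def curvMat (g : C4 → Matrix (Fin 4) (Fin 4) ℂ) (i j : Fin 4) (z : C4) :
    Matrix (Fin 4) (Fin 4) ℂ :=
  Matrix.of fun k l => riemann g k l i j z

section Connection

variable {g : C4 → Matrix (Fin 4) (Fin 4) ℂ}

theorem christoffel_symm (hg : ∀ z, (g z).IsSymm) (k i j : Fin 4) :
    christoffel g k i j = christoffel g k j i := by
  funext z
  have h : ∀ a b, (fun w => g w a b) = fun w => g w b a :=
    fun a b => funext fun w => (hg w).apply b a
  simp only [christoffel]
  congr 1
  refine Finset.sum_congr rfl fun l _ => ?_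
  rw [h i j]
  ring

/-- Lowering the upper index of the Christoffel symbols. -/
theorem sum_mul_christoffel {z : C4} (hdet : IsUnit (g z).det) (k i j : Fin 4) :
    ∑ m, g z k m * christoffel g m i j z = (1 / 2) *
      (pd i (fun w => g w k j) z + pd j (fun w => g w k i) z - pd k (fun w => g w i j) z) := by
  have h : ∀ l, ∑ m, g z k m * (g z)⁻¹ m l = (1 : Matrix (Fin 4) (Fin 4) ℂ) k l := fun l => by
    rw [← Matrix.mul_nonsing_inv _ hdet, Matrix.mul_apply]
  simp only [christoffel, Finset.mul_sum]
  rw [Finset.sum_comm]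
  calc _ = ∑ l, (∑ m, g z k m * (g z)⁻¹ m l) * ((1 / 2) *
      (pd i (fun w => g w l j) z + pd j (fun w => g w l i) z - pd l (fun w => g w i j) z)) := by
        refine Finset.sum_congr rfl fun l _ => ?_
        rw [Finset.sum_mul]
        exact Finset.sum_congr rfl fun m _ => by ring
    _ = _ := by simp [h, Matrix.one_apply]

/-- Metric compatibility, `∂ₖ g = Γₖᵀ g + g Γₖ`. -/
theorem pdMat_metric (hg : ∀ z, (g z).IsSymm) {z : C4} (hdet : IsUnit (g z).det) (k : Fin 4) :
    pdMat k g z = (connMat g k z)ᵀ * g z + g z * connMat g k z := by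
  have h : ∀ a b, (fun w => g w a b) = fun w => g w b a :=
    fun a b => funext fun w => (hg w).apply b a
  ext i j
  have h1 : ((connMat g k z)ᵀ * g z) i j = ∑ m, g z j m * christoffel g m k i z := by
    simp only [Matrix.mul_apply, connMat, Matrix.transpose_apply, Matrix.of_apply]
    exact Finset.sum_congr rfl fun m _ => by rw [(hg z).apply j m]; ring
  rw [Matrix.add_apply, h1, Matrix.mul_apply]
  simp only [connMat, Matrix.of_apply]
  rw [sum_mul_christoffel hdet, sum_mul_christoffel hdet, h j i, h k j, h k i]
  simp only [pdMat, Matrix.of_apply]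
  ring

theorem curvMat_eq (i j : Fin 4) (z : C4) :
    curvMat g i j z = pdMat i (connMat g j) z - pdMat j (connMat g i) z
      + (connMat g i z * connMat g j z - connMat g j z * connMat g i z) := by
  ext k l
  simp only [curvMat, riemann, Matrix.add_apply, Matrix.sub_apply, Matrix.mul_apply, pdMat,
    connMat, Matrix.of_apply, Finset.sum_sub_distrib]

theorem curvMat_swap (i j : Fin 4) (z : C4) : curvMat g j i z = -curvMat g i j z := by
  rw [curvMat_eq, curvMat_eq]
  abel

/-- The first Bianchi identity. -/
theorem riemann_bianchi (hg : ∀ z, (g z).IsSymm) (k l i j : Fin 4) (z : C4) :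
    riemann g k l i j z + riemann g k i j l z + riemann g k j l i z = 0 := by
  simp only [riemann, Finset.sum_sub_distrib]
  rw [christoffel_symm hg k j l, christoffel_symm hg k i l, christoffel_symm hg k j i]
  have h : ∀ m a b, christoffel g m a b z = christoffel g m b a z :=
    fun m a b => by rw [christoffel_symm hg]
  simp only [h _ j l, h _ i l, h _ j i]
  ring

theorem analyticAt_christoffel {z : C4} (hg : ∀ i j, AnalyticAt ℂ (fun w => g w i j) z)
    (hinv : ∀ i j, AnalyticAt ℂ (fun w => (g w)⁻¹ i j) z) (k i j : Fin 4) :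
    AnalyticAt ℂ (christoffel g k i j) z := by
  unfold christoffel
  refine analyticAt_const.mul (Finset.analyticAt_fun_sum _ fun l _ => (hinv k l).mul ?_)
  exact ((analyticAt_pd i (hg l j)).add (analyticAt_pd j (hg l i))).sub (analyticAt_pd l (hg i j))

/-- A covariantly constant 2-tensor is annihilated by the curvature: the integrability condition
`Rᵢⱼᵀ X + X Rᵢⱼ = 0` of `∂ₖ X = Γₖᵀ X + X Γₖ`. -/
theorem curvMat_of_parallel {V : Set C4} (hV : IsOpen V) {z : C4} (hz : z ∈ V)
    {X : C4 → Matrix (Fin 4) (Fin 4) ℂ}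
    (hX : ∀ i j, AnalyticAt ℂ (fun w => X w i j) z)
    (hΓ : ∀ k i j, DifferentiableAt ℂ (christoffel g k i j) z)
    (hpar : ∀ w ∈ V, ∀ k, pdMat k X w = (connMat g k w)ᵀ * X w + X w * connMat g k w)
    (i j : Fin 4) :
    (curvMat g i j z)ᵀ * X z + X z * curvMat g i j z = 0 := by
  have hXd : ∀ i j, DifferentiableAt ℂ (fun w => X w i j) z := fun i j => (hX i j).differentiableAt
  have hΓd : ∀ k i j, DifferentiableAt ℂ (fun w => connMat g k w i j) z := fun k i j => hΓ i k j
  have hΓt : ∀ k i j, DifferentiableAt ℂ (fun w => (connMat g k w)ᵀ i j) z :=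
    fun k i j => hΓ j k i
  have key : ∀ k l, pdMat k (pdMat l X) z
      = (pdMat k (connMat g l) z)ᵀ * X z
        + (connMat g l z)ᵀ * ((connMat g k z)ᵀ * X z + X z * connMat g k z)
        + (((connMat g k z)ᵀ * X z + X z * connMat g k z) * connMat g l z
        + X z * pdMat k (connMat g l) z) := by
    intro k l
    have heq : pdMat l X =ᶠ[𝓝 z] fun w => (connMat g l w)ᵀ * X w + X w * connMat g l w :=
      Filter.eventuallyEq_of_mem (hV.mem_nhds hz) fun w hw => hpar w hw l
    rw [pdMat_congr heq, pdMat_add k (differentiableAt_matrix_mul (hΓt l) hXd)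
      (differentiableAt_matrix_mul hXd (hΓd l)), pdMat_mul k (hΓt l) hXd,
      pdMat_mul k hXd (hΓd l), hpar z hz k]
    rfl
  have hcomm := pdMat_comm i j hX
  rw [key, key] at hcomm
  rw [curvMat_eq]
  simp only [Matrix.transpose_add, Matrix.transpose_sub, Matrix.transpose_mul]
  rw [← sub_eq_zero] at hcomm
  rw [← hcomm]
  noncomm_ring

end Connection

/-! ### Linear algebra of a null frame -/

/-- The Gram matrix of a null tetrad `(W, Z, W̃, Z̃)`. -/
def nullGram : Matrix (Fin 4) (Fin 4) ℂ :=
  !![0, 0, -1, 0; 0, 0, 0, 1; -1, 0, 0, 0; 0, 1, 0, 0]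

/-- A basis of the self-dual 2-forms in a null coframe: `ω³ ∧ ω⁴`, `ω¹ ∧ ω²` and
`ω¹ ∧ ω³ - ω² ∧ ω⁴`. -/
def sdForm : Fin 3 → Matrix (Fin 4) (Fin 4) ℂ :=
  ![!![0, 0, 0, 0; 0, 0, 0, 0; 0, 0, 0, 1; 0, 0, -1, 0],
    !![0, 1, 0, 0; -1, 0, 0, 0; 0, 0, 0, 0; 0, 0, 0, 0],
    !![0, 0, 1, 0; 0, 0, 0, -1; -1, 0, 0, 0; 0, 1, 0, 0]]

/-- The general anti-self-dual 2-form in a null coframe,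
`x₀ ω¹ ∧ ω⁴ + x₁ ω² ∧ ω³ + x₂ (ω¹ ∧ ω³ + ω² ∧ ω⁴)`. -/
def asdForm (x : Fin 3 → ℂ) : Matrix (Fin 4) (Fin 4) ℂ :=
  !![0, 0, x 2, x 0; 0, 0, x 1, x 2; -x 2, -x 1, 0, 0; -x 0, -x 2, 0, 0]

theorem nullGram_mul_self : nullGram * nullGram = 1 := by
  ext i j
  fin_cases i <;> fin_cases j <;> simp [nullGram, Matrix.mul_apply, Fin.sum_univ_four]

theorem nullGram_transpose : nullGramᵀ = nullGram := by
  ext i j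
  fin_cases i <;> fin_cases j <;> simp [nullGram]

theorem sdForm_antisymm (a : Fin 3) (i j : Fin 4) : sdForm a i j = -sdForm a j i := by
  fin_cases a <;> fin_cases i <;> fin_cases j <;> simp [sdForm]

/-- The orthogonal Lie algebra of `nullGram` consists of the antisymmetric matrices with one
index raised. -/
theorem exists_eq_nullGram_mul {A : Matrix (Fin 4) (Fin 4) ℂ}
    (hA : Aᵀ * nullGram + nullGram * A = 0) :
    ∃ a b c d e f : ℂ,
      A = nullGram * !![0, a, b, c; -a, 0, d, e; -b, -d, 0, f; -c, -e, -f, 0] := by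
  have hQ : (nullGram * A)ᵀ = -(nullGram * A) := by
    rw [Matrix.transpose_mul, nullGram_transpose]
    exact eq_neg_of_add_eq_zero_left hA
  have hA' : A = nullGram * (nullGram * A) := by
    rw [← Matrix.mul_assoc, nullGram_mul_self, Matrix.one_mul]
  generalize nullGram * A = Q at hQ hA'
  have h : ∀ i j, Q j i = -Q i j := fun i j => congrFun (congrFun hQ i) j
  have h' : ∀ i, Q i i = 0 := fun i => self_eq_neg.mp (h i i)
  refine ⟨Q 0 1, Q 0 2, Q 0 3, Q 1 2, Q 1 3, Q 2 3, ?_⟩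
  rw [hA']
  congr 1
  ext i j
  fin_cases i <;> fin_cases j <;> simp [h'] <;> exact h _ _

/-- The orthogonal Lie algebra acts on the self-dual 2-forms through three parameters. -/
theorem sdForm_action (a b c d e f : ℂ) {A : Matrix (Fin 4) (Fin 4) ℂ}
    (hA : A = nullGram * !![0, a, b, c; -a, 0, d, e; -b, -d, 0, f; -c, -e, -f, 0]) :
    Aᵀ * sdForm 0 + sdForm 0 * A = a • sdForm 2 - (b - e) • sdForm 0 ∧
    Aᵀ * sdForm 1 + sdForm 1 * A = (b - e) • sdForm 1 - f • sdForm 2 ∧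
    Aᵀ * sdForm 2 + sdForm 2 * A = (2 * f) • sdForm 0 - (2 * a) • sdForm 1 := by
  have hA' : A = !![b, d, 0, -f; -c, -e, -f, 0; 0, -a, -b, -c; -a, 0, d, e] := by
    rw [hA]
    ext i j
    fin_cases i <;> fin_cases j <;> simp [nullGram, Matrix.mul_apply, Fin.sum_univ_four]
  subst hA'
  refine ⟨?_, ?_, ?_⟩ <;> ext i j <;> fin_cases i <;> fin_cases j <;>
    simp [sdForm, Matrix.mul_apply, Fin.sum_univ_four] <;> ring

/-- The stabiliser of the self-dual 2-forms in the orthogonal Lie algebra consists of the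
anti-self-dual 2-forms with one index raised. -/
theorem exists_eq_asdForm {r : Matrix (Fin 4) (Fin 4) ℂ} (hr : rᵀ * nullGram + nullGram * r = 0)
    (hS : ∀ s, rᵀ * sdForm s + sdForm s * r = 0) :
    ∃ x, r = nullGram * asdForm x := by
  obtain ⟨a, b, c, d, e, f, h⟩ := exists_eq_nullGram_mul hr
  obtain ⟨h0, h1, -⟩ := sdForm_action a b c d e f h
  rw [hS] at h0 h1
  have ha : 0 = a := by simpa [sdForm] using congrFun (congrFun h0 0) 2
  have hf : f = 0 := by simpa [sdForm] using congrFun (congrFun h1 0) 2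
  have hbe : 0 = b - e := by simpa [sdForm] using congrFun (congrFun h1 0) 1
  obtain rfl : b = e := (sub_eq_zero.mp hbe.symm)
  subst ha hf
  refine ⟨![c, d, b], ?_⟩
  rw [h]
  simp [asdForm]

/-- Uniqueness of the metric connection on the bundle of self-dual 2-forms: if all the `sdForm`s
are closed for a metric connection, given by its matrices `A c` in the frame, then they are
parallel. -/
theorem parallel_of_closed {A : Fin 4 → Matrix (Fin 4) (Fin 4) ℂ}
    (hA : ∀ c, (A c)ᵀ * nullGram + nullGram * A c = 0)
    (hcl : ∀ s a b c, ((A a)ᵀ * sdForm s + sdForm s * A a) b c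
      + ((A b)ᵀ * sdForm s + sdForm s * A b) c a
      + ((A c)ᵀ * sdForm s + sdForm s * A c) a b = 0) (s : Fin 3) (c : Fin 4) :
    (A c)ᵀ * sdForm s + sdForm s * A c = 0 := by
  choose p p₂ p₃ p₄ p₅ q hp using fun c => exists_eq_nullGram_mul (hA c)
  have hT := fun c => sdForm_action _ _ _ _ _ _ (hp c)
  have h0 := hcl 0
  have h1 := hcl 1
  have h2 := hcl 2
  simp only [(hT _).1] at h0
  simp only [(hT _).2.1] at h1
  simp only [(hT _).2.2] at h2
  have hp0 : p 0 = 0 := by simpa [sdForm] using h0 0 1 3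
  have hp1 : p 1 = 0 := by simpa [sdForm] using h0 0 1 2
  have hp2 : p 2 = 0 := by simpa [sdForm] using h2 0 1 2
  have hp3 : p 3 = 0 := by simpa [sdForm] using h2 0 1 3
  have hq0 : q 0 = 0 := by simpa [sdForm] using h2 0 2 3
  have hq1 : q 1 = 0 := by simpa [sdForm] using h2 1 2 3
  have hq2 : q 2 = 0 := by simpa [sdForm] using h1 1 2 3
  have hq3 : q 3 = 0 := by simpa [sdForm] using h1 0 2 3
  have hr0 : p₂ 0 - p₅ 0 = 0 := by
    rw [← neg_eq_zero]
    simpa [sdForm, hp3] using h0 0 2 3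
  have hr1 : p₂ 1 - p₅ 1 = 0 := by
    rw [← neg_eq_zero]
    simpa [sdForm, hp2] using h0 1 2 3
  have hr2 : p₂ 2 - p₅ 2 = 0 := by simpa [sdForm, hq1] using h1 0 1 2
  have hr3 : p₂ 3 - p₅ 3 = 0 := by simpa [sdForm, hq0] using h1 0 1 3
  -- `p`, `q` and `p₂ - p₅` are the components of the connection on the self-dual 2-forms
  have hpc : ∀ c, p c = 0 := by simp [Fin.forall_fin_succ, hp0, hp1, hp2, hp3]
  have hqc : ∀ c, q c = 0 := by simp [Fin.forall_fin_succ, hq0, hq1, hq2, hq3]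
  have hrc : ∀ c, p₂ c - p₅ c = 0 := by simp [Fin.forall_fin_succ, hr0, hr1, hr2, hr3]
  fin_cases s
  · exact (hT c).1.trans (by simp [hpc, hrc])
  · exact (hT c).2.1.trans (by simp [hqc, hrc])
  · exact (hT c).2.2.trans (by simp [hpc, hqc])

/-- A curvature tensor whose endomorphisms are all anti-self-dual is Ricci-flat, by the first
Bianchi identity. -/
theorem sum_eq_zero_of_bianchi {r : Fin 4 → Fin 4 → Matrix (Fin 4) (Fin 4) ℂ}
    (hasd : ∀ c d, ∃ x, r c d = nullGram * asdForm x) (hswap : ∀ c d, r d c = -r c d)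
    (hb : ∀ a b c d, r c d a b + r d b a c + r b c a d = 0) (b d : Fin 4) :
    ∑ a, r a d a b = 0 := by
  choose x hx using hasd
  have hr : ∀ c d, r c d = !![x c d 2, x c d 1, 0, 0; -x c d 0, -x c d 2, 0, 0;
      0, 0, -x c d 2, -x c d 0; 0, 0, x c d 1, x c d 2] := by
    intro c d
    rw [hx]
    ext i j
    fin_cases i <;> fin_cases j <;> simp [nullGram, asdForm, Matrix.mul_apply, Fin.sum_univ_four]
  have hs : ∀ c d k, x d c k = -x c d k := by
    intro c d k
    have h := fun i j => congrFun (congrFun (hswap c d) i) j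
    simp only [hr] at h
    fin_cases k
    · have h10 := h 1 0
      simp at h10
      exact neg_eq_iff_eq_neg.mp h10
    · simpa using h 0 1
    · simpa using h 0 0
  have h01 : ∀ k, x 0 1 k = 0 := by
    intro k
    fin_cases k
    · simpa [hr] using hb 2 0 1 3
    · simpa [hr] using hb 3 0 1 2
    · simpa [hr] using hb 2 0 1 2
  have h23 : ∀ k, x 2 3 k = 0 := by
    intro k
    fin_cases k
    · simpa [hr] using hb 1 2 3 0
    · simpa [hr] using hb 0 2 3 1
    · simpa [hr] using hb 0 2 3 0
  fin_cases b
  · have h := hb 1 0 1 d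
    have h' : r 0 1 1 d = 0 := by rw [hr]; fin_cases d <;> simp [h01]
    rw [h'] at h
    simp [hr, Fin.sum_univ_four] at h ⊢
    linear_combination h + hs 0 d 2
  · have h := hb 0 0 1 d
    have h' : r 0 1 0 d = 0 := by rw [hr]; fin_cases d <;> simp [h01]
    rw [h'] at h
    simp [hr, Fin.sum_univ_four] at h ⊢
    linear_combination -h + hs 0 d 1
  · have h := hb 3 2 3 d
    have h' : r 2 3 3 d = 0 := by rw [hr]; fin_cases d <;> simp [h23]
    rw [h'] at h
    simp [hr, Fin.sum_univ_four] at h ⊢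
    linear_combination h - hs 2 d 2
  · have h := hb 2 2 3 d
    have h' : r 2 3 2 d = 0 := by rw [hr]; fin_cases d <;> simp [h23]
    rw [h'] at h
    simp [hr, Fin.sum_univ_four] at h ⊢
    linear_combination -h - hs 2 d 0

/-- Contraction with the determinant of the frame components sends `asdForm x` to twice itself.
The orientation in which `(e₀, e₂, e₁, e₃)` is positive is the opposite of the one given by this
determinant, so there `asdForm x` is anti-self-dual. -/
theorem asdForm_dual (x : Fin 3 → ℂ) (f h : Fin 4 → ℂ) :
    ∑ a, ∑ b, Matrix.det (Matrix.of ![f, h, Pi.single a 1, Pi.single b 1]) *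
      (nullGram * asdForm x * nullGram) a b = 2 * f ⬝ᵥ (asdForm x *ᵥ h) := by
  have h1 : nullGram * asdForm x * nullGram
      = !![0, 0, -x 2, x 1; 0, 0, x 0, -x 2; x 2, -x 0, 0, 0; -x 1, x 2, 0, 0] := by
    ext i j
    fin_cases i <;> fin_cases j <;> simp [nullGram, asdForm, Matrix.mul_apply, Fin.sum_univ_four]
  rw [h1]
  simp [asdForm, Matrix.det_succ_row_zero, Fin.sum_univ_succ, Fin.succAbove, Matrix.mulVec,
    dotProduct]
  ring

/-! ### Hyperkähler frames -/

/-- A holomorphic null coframe `F` of `g` on `V` (the rows of `F z` are the four 1-forms), with dual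
frame `E` (the columns of `E z`), whose associated basis of self-dual 2-forms is closed. -/
structure IsHyperkahlerFrame (g F E : C4 → Matrix (Fin 4) (Fin 4) ℂ) (V : Set C4) : Prop where
  analytic_coframe : ∀ i j, AnalyticOnNhd ℂ (fun z => F z i j) V
  analytic_frame : ∀ i j, AnalyticOnNhd ℂ (fun z => E z i j) V
  mul_eq_one : ∀ z ∈ V, F z * E z = 1
  metric_eq : ∀ z ∈ V, g z = (F z)ᵀ * nullGram * F z
  closed : ∀ s, ∀ z ∈ V, ∀ i j k,
    pd i (fun w => ((F w)ᵀ * sdForm s * F w) j k) z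
      + pd j (fun w => ((F w)ᵀ * sdForm s * F w) k i) z
      + pd k (fun w => ((F w)ᵀ * sdForm s * F w) i j) z = 0

/-- If a 3-tensor has vanishing cyclic sum, so does its pull-back by a linear map. -/
theorem cyclic_sum_contract (E : Matrix (Fin 4) (Fin 4) ℂ) {N : Fin 4 → Fin 4 → Fin 4 → ℂ}
    (hN : ∀ i j k, N i j k + N j k i + N k i j = 0) (a b c : Fin 4) :
    (∑ i, ∑ j, ∑ k, E i a * E j b * E k c * N i j k)
      + (∑ i, ∑ j, ∑ k, E i b * E j c * E k a * N i j k)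
      + (∑ i, ∑ j, ∑ k, E i c * E j a * E k b * N i j k) = 0 := by
  have h2 : (∑ i, ∑ j, ∑ k, E i b * E j c * E k a * N i j k)
      = ∑ i, ∑ j, ∑ k, E i a * E j b * E k c * N j k i := by
    rw [Finset.sum_comm_cycle]
    refine Finset.sum_congr rfl fun i _ => Finset.sum_congr rfl fun j _ =>
      Finset.sum_congr rfl fun k _ => by ring
  have h3 : (∑ i, ∑ j, ∑ k, E i c * E j a * E k b * N i j k)
      = ∑ i, ∑ j, ∑ k, E i a * E j b * E k c * N k i j := by
    rw [Finset.sum_comm_cycle, Finset.sum_comm_cycle]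
    refine Finset.sum_congr rfl fun i _ => Finset.sum_congr rfl fun j _ =>
      Finset.sum_congr rfl fun k _ => by ring
  rw [h2, h3]
  simp only [← Finset.sum_add_distrib, ← mul_add, hN, mul_zero, Finset.sum_const_zero]

theorem congruence_cancel {E F M : Matrix (Fin 4) (Fin 4) ℂ} (hFE : F * E = 1)
    (h : Fᵀ * M * F = 0) : M = 0 := by
  have hEF : Eᵀ * Fᵀ = 1 := by rw [← Matrix.transpose_mul, hFE, Matrix.transpose_one]
  calc M = (Eᵀ * Fᵀ) * M * (F * E) := by rw [hEF, hFE, Matrix.one_mul, Matrix.mul_one]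
    _ = Eᵀ * (Fᵀ * M * F) * E := by simp only [Matrix.mul_assoc]
    _ = 0 := by rw [h, Matrix.mul_zero, Matrix.zero_mul]

theorem pdMat_congruence {F : C4 → Matrix (Fin 4) (Fin 4) ℂ} {z : C4}
    (hF : ∀ i j, DifferentiableAt ℂ (fun w => F w i j) z) (S : Matrix (Fin 4) (Fin 4) ℂ)
    (k : Fin 4) :
    pdMat k (fun w => (F w)ᵀ * S * F w) z
      = (pdMat k F z)ᵀ * S * F z + (F z)ᵀ * S * pdMat k F z := by
  have hFt : ∀ i j, DifferentiableAt ℂ (fun w => (F w)ᵀ i j) z := fun i j => hF j i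
  have hS : ∀ i j, DifferentiableAt ℂ (fun _ : C4 => S i j) z := fun i j => differentiableAt_const _
  rw [pdMat_mul k (differentiableAt_matrix_mul hFt hS) hF, pdMat_mul k hFt hS, pdMat_const,
    Matrix.mul_zero, add_zero, pdMat_transpose]

namespace IsHyperkahlerFrame

variable {g F E : C4 → Matrix (Fin 4) (Fin 4) ℂ} {V : Set C4}

theorem mul_eq_one' (h : IsHyperkahlerFrame g F E V) {z : C4} (hz : z ∈ V) : E z * F z = 1 :=
  mul_eq_one_comm.mp (h.mul_eq_one z hz)

theorem metric_mul_inv (h : IsHyperkahlerFrame g F E V) {z : C4} (hz : z ∈ V) :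
    g z * (E z * nullGram * (E z)ᵀ) = 1 := by
  have hEF : (F z)ᵀ * (E z)ᵀ = 1 := by
    rw [← Matrix.transpose_mul, h.mul_eq_one' hz, Matrix.transpose_one]
  calc g z * (E z * nullGram * (E z)ᵀ)
      = (F z)ᵀ * (nullGram * (F z * E z) * nullGram) * (E z)ᵀ := by
        rw [h.metric_eq z hz]; simp only [Matrix.mul_assoc]
    _ = 1 := by rw [h.mul_eq_one z hz, Matrix.mul_one, nullGram_mul_self, Matrix.mul_one, hEF]

theorem isUnit_det (h : IsHyperkahlerFrame g F E V) {z : C4} (hz : z ∈ V) :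
    IsUnit (g z).det :=
  Matrix.isUnit_det_of_right_inverse (h.metric_mul_inv hz)

theorem inv_eq (h : IsHyperkahlerFrame g F E V) {z : C4} (hz : z ∈ V) :
    (g z)⁻¹ = E z * nullGram * (E z)ᵀ :=
  Matrix.inv_eq_right_inv (h.metric_mul_inv hz)

theorem inner2_eq (h : IsHyperkahlerFrame g F E V) {z : C4} (hz : z ∈ V) (v w : C4) :
    inner2 g z v w = (F z *ᵥ v) ⬝ᵥ (nullGram *ᵥ (F z *ᵥ w)) := by
  rw [inner2, h.metric_eq z hz, Matrix.mul_assoc, ← Matrix.mulVec_mulVec, ← Matrix.mulVec_mulVec,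
    Matrix.dotProduct_mulVec, Matrix.vecMul_transpose]

theorem inner2_frame (h : IsHyperkahlerFrame g F E V) {z : C4} (hz : z ∈ V) (a d : Fin 4) :
    inner2 g z (fun i => E z i a) (fun i => E z i d) = nullGram a d := by
  have hcol : ∀ a, F z *ᵥ (fun i => E z i a) = Pi.single a 1 := by
    intro a
    ext i
    have := congrFun (congrFun (h.mul_eq_one z hz) i) a
    rw [Matrix.mul_apply] at this
    simpa [Matrix.mulVec, dotProduct, Matrix.one_apply, Pi.single_apply] using this
  rw [h.inner2_eq hz, hcol, hcol]
  simp

theorem sq_eq_det (h : IsHyperkahlerFrame g F E V) {z : C4} (hz : z ∈ V) {r : ℂ}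
    (hr : r * (E z).det = -1) : r ^ 2 = (g z).det := by
  have hη : nullGram.det = 1 := by
    simp [nullGram, Matrix.det_succ_row_zero, Fin.sum_univ_succ, Fin.succAbove]
  have hFE : (F z).det * (E z).det = 1 := by
    rw [← Matrix.det_mul, h.mul_eq_one z hz, Matrix.det_one]
  have hrF : r = -(F z).det := by
    linear_combination (F z).det * hr - r * hFE
  rw [h.metric_eq z hz, Matrix.det_mul, Matrix.det_mul, Matrix.det_transpose, hη, hrF]
  ring

theorem analyticAt_congruence (h : IsHyperkahlerFrame g F E V) {z : C4} (hz : z ∈ V)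
    (S : Matrix (Fin 4) (Fin 4) ℂ) (i j : Fin 4) :
    AnalyticAt ℂ (fun w => ((F w)ᵀ * S * F w) i j) z := by
  have hF : ∀ i j, AnalyticAt ℂ (fun w => F w i j) z := fun i j => h.analytic_coframe i j z hz
  exact analyticAt_matrix_mul (analyticAt_matrix_mul (X := fun w => (F w)ᵀ) (Y := fun _ => S)
    (fun i j => hF j i) fun _ _ => analyticAt_const) hF i j

theorem analyticAt_metric (h : IsHyperkahlerFrame g F E V) (hV : IsOpen V) {z : C4} (hz : z ∈ V)
    (i j : Fin 4) : AnalyticAt ℂ (fun w => g w i j) z := by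
  refine (h.analyticAt_congruence hz nullGram i j).congr ?_
  filter_upwards [hV.mem_nhds hz] with w hw
  rw [h.metric_eq w hw]

theorem analyticAt_inv (h : IsHyperkahlerFrame g F E V) (hV : IsOpen V) {z : C4} (hz : z ∈ V)
    (i j : Fin 4) : AnalyticAt ℂ (fun w => (g w)⁻¹ i j) z := by
  have hE : ∀ i j, AnalyticAt ℂ (fun w => E w i j) z := fun i j => h.analytic_frame i j z hz
  have h1 : AnalyticAt ℂ (fun w => (E w * nullGram * (E w)ᵀ) i j) z :=
    analyticAt_matrix_mul (analyticAt_matrix_mul (X := E) (Y := fun _ => nullGram) hE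
      fun _ _ => analyticAt_const) (Y := fun w => (E w)ᵀ) (fun i j => hE j i) i j
  refine h1.congr ?_
  filter_upwards [hV.mem_nhds hz] with w hw
  rw [h.inv_eq hw]

/-- The self-dual 2-forms of a hyperkähler frame are covariantly constant. -/
theorem parallel (h : IsHyperkahlerFrame g F E V) (hg : ∀ z, (g z).IsSymm) (hV : IsOpen V)
    (s : Fin 3) {z : C4} (hz : z ∈ V) (k : Fin 4) :
    pdMat k (fun w => (F w)ᵀ * sdForm s * F w) z
      = (connMat g k z)ᵀ * ((F z)ᵀ * sdForm s * F z)
        + (F z)ᵀ * sdForm s * F z * connMat g k z := by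
  have hFE := h.mul_eq_one z hz
  have hEF := h.mul_eq_one' hz
  have hFd : ∀ i j, DifferentiableAt ℂ (fun w => F w i j) z :=
    fun i j => (h.analytic_coframe i j z hz).differentiableAt
  -- the connection matrices in the moving frame, `B k = (F Γₖ - ∂ₖF) F⁻¹`
  obtain ⟨B, hBF⟩ : ∃ B : Fin 4 → Matrix (Fin 4) (Fin 4) ℂ,
      ∀ k, B k * F z = F z * connMat g k z - pdMat k F z :=
    ⟨fun k => (F z * connMat g k z - pdMat k F z) * E z, fun k => by
      rw [Matrix.mul_assoc, hEF, Matrix.mul_one]⟩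
  have hcov : ∀ S k, pdMat k (fun w => (F w)ᵀ * S * F w) z
      = (connMat g k z)ᵀ * ((F z)ᵀ * S * F z) + (F z)ᵀ * S * F z * connMat g k z
        - (F z)ᵀ * ((B k)ᵀ * S + S * B k) * F z := by
    intro S k
    have e : (F z)ᵀ * ((B k)ᵀ * S + S * B k) * F z
        = (B k * F z)ᵀ * S * F z + (F z)ᵀ * S * (B k * F z) := by
      rw [Matrix.transpose_mul]
      noncomm_ring
    rw [pdMat_congruence hFd, e, hBF]
    simp only [Matrix.transpose_sub, Matrix.transpose_mul]
    noncomm_ring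
  have hskew : ∀ k, (B k)ᵀ * nullGram + nullGram * B k = 0 := by
    intro k
    refine congruence_cancel hFE ?_
    have h1 := hcov nullGram k
    have h2 : pdMat k (fun w => (F w)ᵀ * nullGram * F w) z = pdMat k g z :=
      pdMat_congr (eventuallyEq_of_mem (hV.mem_nhds hz) fun w hw => (h.metric_eq w hw).symm)
    rw [h2, pdMat_metric hg (h.isUnit_det hz), h.metric_eq z hz] at h1
    exact sub_eq_self.mp h1.symm
  -- `T s k` holds the frame components of minus the covariant derivative of the `s`-th 2-form in
  -- the direction `∂ₖ`
  set T : Fin 3 → Fin 4 → Matrix (Fin 4) (Fin 4) ℂ :=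
    fun s k => (B k)ᵀ * sdForm s + sdForm s * B k with hT
  have hcl : ∀ s i j k, ((F z)ᵀ * T s i * F z) j k + ((F z)ᵀ * T s j * F z) k i
      + ((F z)ᵀ * T s k * F z) i j = 0 := by
    intro s i j k
    have hanti : ∀ i j, ((F z)ᵀ * sdForm s * F z) i j = -((F z)ᵀ * sdForm s * F z) j i := by
      have hS : (sdForm s)ᵀ = -sdForm s := by
        ext i j
        simpa using sdForm_antisymm s j i
      have : ((F z)ᵀ * sdForm s * F z)ᵀ = -((F z)ᵀ * sdForm s * F z) := by
        simp only [Matrix.transpose_mul, Matrix.transpose_transpose, hS, Matrix.mul_assoc,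
          Matrix.neg_mul, Matrix.mul_neg]
      exact fun i j => congrFun (congrFun this j) i
    have hΓ : ∀ m i j, connMat g i z m j = connMat g j z m i := fun m i j => by
      simp only [connMat, Matrix.of_apply]
      rw [christoffel_symm hg]
    have h1 := h.closed s z hz i j k
    change pdMat i (fun w => (F w)ᵀ * sdForm s * F w) z j k
      + pdMat j (fun w => (F w)ᵀ * sdForm s * F w) z k i
      + pdMat k (fun w => (F w)ᵀ * sdForm s * F w) z i j = 0 at h1
    rw [hcov, hcov, hcov] at h1
    have h2 : ∀ i j k, ((connMat g i z)ᵀ * ((F z)ᵀ * sdForm s * F z)) j k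
        = -((F z)ᵀ * sdForm s * F z * connMat g j z) k i := by
      intro i j k
      rw [Matrix.mul_apply, Matrix.mul_apply, ← Finset.sum_neg_distrib]
      refine Finset.sum_congr rfl fun m _ => ?_
      rw [Matrix.transpose_apply, hΓ m i j, hanti m k]
      ring
    simp only [Matrix.sub_apply, Matrix.add_apply, h2] at h1
    linear_combination -h1
  -- pass to components in the frame
  have hframe : ∀ s c, ((∑ k, E z k c • B k)ᵀ * sdForm s + sdForm s * ∑ k, E z k c • B k)
      = ∑ k, E z k c • T s k := by
    intro s c
    simp only [hT, Matrix.transpose_sum, Matrix.transpose_smul, Matrix.sum_mul, Matrix.mul_sum,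
      Matrix.smul_mul, Matrix.mul_smul, smul_add, Finset.sum_add_distrib]
  have hzero : ∀ s c, ∑ k, E z k c • T s k = 0 := by
    intro s c
    rw [← hframe]
    refine parallel_of_closed (A := fun c => ∑ k, E z k c • B k) (fun c => ?_) ?_ s c
    · have : ∀ k, E z k c • ((B k)ᵀ * nullGram) + E z k c • (nullGram * B k) = 0 := fun k => by
        rw [← smul_add, hskew, smul_zero]
      simp only [Matrix.transpose_sum, Matrix.transpose_smul, Matrix.sum_mul, Matrix.mul_sum,
        Matrix.smul_mul, Matrix.mul_smul, ← Finset.sum_add_distrib, this, Finset.sum_const_zero]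
    · intro s a b c
      simp only [hframe]
      have hcomp : ∀ a b c, (∑ k, E z k a • T s k) b c
          = ∑ i, ∑ j, ∑ k, E z i a * E z j b * E z k c * ((F z)ᵀ * T s i * F z) j k := by
        intro a b c
        have e : ∀ i, T s i = (E z)ᵀ * ((F z)ᵀ * T s i * F z) * E z := fun i => by
          have hEFt : (E z)ᵀ * (F z)ᵀ = 1 := by
            rw [← Matrix.transpose_mul, hFE, Matrix.transpose_one]
          calc T s i = ((E z)ᵀ * (F z)ᵀ) * T s i * (F z * E z) := by
                rw [hEFt, hFE, Matrix.one_mul, Matrix.mul_one]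
            _ = _ := by simp only [Matrix.mul_assoc]
        rw [Matrix.sum_apply]
        refine Finset.sum_congr rfl fun i _ => ?_
        rw [Matrix.smul_apply]
        conv_lhs => rw [e i]
        generalize (F z)ᵀ * T s i * F z = N
        simp only [Matrix.mul_apply, Matrix.transpose_apply, smul_eq_mul, Finset.mul_sum,
          Finset.sum_mul]
        rw [Finset.sum_comm]
        exact Finset.sum_congr rfl fun j _ => Finset.sum_congr rfl fun k _ => by ring
      rw [hcomp, hcomp, hcomp]
      exact cyclic_sum_contract (E z) (N := fun i j k => ((F z)ᵀ * T s i * F z) j k) (hcl s) a b c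
  have hTk : T s k = 0 := by
    have : ∑ c, F z c k • ∑ l, E z l c • T s l = T s k := by
      simp only [Finset.smul_sum, smul_smul]
      rw [Finset.sum_comm]
      have e : ∀ l, ∑ c, F z c k * E z l c = (1 : Matrix (Fin 4) (Fin 4) ℂ) l k := fun l => by
        rw [← hEF, Matrix.mul_apply]
        exact Finset.sum_congr rfl fun c _ => mul_comm _ _
      simp only [← Finset.sum_smul, e, Matrix.one_apply, ite_smul, one_smul, zero_smul,
        Finset.sum_ite_eq', Finset.mem_univ, if_true]
    rw [← this]
    simp only [hzero, smul_zero, Finset.sum_const_zero]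
  rw [hcov, show (B k)ᵀ * sdForm s + sdForm s * B k = 0 from hTk, Matrix.mul_zero, Matrix.zero_mul,
    sub_zero]

/-- The curvature endomorphisms of a hyperkähler frame are anti-self-dual. -/
theorem curvMat_asd (h : IsHyperkahlerFrame g F E V) (hg : ∀ z, (g z).IsSymm) (hV : IsOpen V)
    {z : C4} (hz : z ∈ V) (i j : Fin 4) :
    ∃ x, F z * curvMat g i j z * E z = nullGram * asdForm x := by
  have hFE := h.mul_eq_one z hz
  have hEF := h.mul_eq_one' hz
  have hΓ : ∀ k i j, DifferentiableAt ℂ (christoffel g k i j) z := fun k i j =>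
    (analyticAt_christoffel (h.analyticAt_metric hV hz) (h.analyticAt_inv hV hz) k i
      j).differentiableAt
  have key : ∀ S, (curvMat g i j z)ᵀ * ((F z)ᵀ * S * F z) + (F z)ᵀ * S * F z * curvMat g i j z = 0 →
      (F z * curvMat g i j z * E z)ᵀ * S + S * (F z * curvMat g i j z * E z) = 0 := by
    intro S hS
    refine congruence_cancel hFE ?_
    have h1 : (F z)ᵀ * ((F z * curvMat g i j z * E z)ᵀ * S + S * (F z * curvMat g i j z * E z))
        * F z = (E z * F z)ᵀ * (curvMat g i j z)ᵀ * ((F z)ᵀ * S * F z)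
          + (F z)ᵀ * S * F z * curvMat g i j z * (E z * F z) := by
      simp only [Matrix.transpose_mul]
      noncomm_ring
    rw [h1, hEF, Matrix.transpose_one, Matrix.one_mul, Matrix.mul_one, hS]
  refine exists_eq_asdForm (key _ ?_) fun s => key _ ?_
  · rw [← h.metric_eq z hz]
    exact curvMat_of_parallel hV hz (h.analyticAt_metric hV hz) hΓ
      (fun w hw k => pdMat_metric hg (h.isUnit_det hw) k) i j
  · exact curvMat_of_parallel hV hz (X := fun w => (F w)ᵀ * sdForm s * F w)
      (h.analyticAt_congruence hz _) hΓ (fun w hw k => h.parallel hg hV s hw k) i j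

/-- A metric with a hyperkähler frame is Ricci-flat. -/
theorem ricci_eq_zero (h : IsHyperkahlerFrame g F E V) (hg : ∀ z, (g z).IsSymm) (hV : IsOpen V)
    {z : C4} (hz : z ∈ V) (l j : Fin 4) : ricci g l j z = 0 := by
  have hFE := h.mul_eq_one z hz
  have hEF := h.mul_eq_one' hz
  -- the curvature endomorphisms in the frame
  set r : Fin 4 → Fin 4 → Matrix (Fin 4) (Fin 4) ℂ := fun c d =>
    ∑ i, ∑ j, (E z i c * E z j d) • (F z * curvMat g i j z * E z) with hr
  have hrasd : ∀ c d, ∃ x, r c d = nullGram * asdForm x := by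
    intro c d
    choose x hx using fun i j => h.curvMat_asd hg hV hz i j
    refine ⟨∑ i, ∑ j, (E z i c * E z j d) • x i j, ?_⟩
    have hlin : asdForm (∑ i, ∑ j, (E z i c * E z j d) • x i j)
        = ∑ i, ∑ j, (E z i c * E z j d) • asdForm (x i j) := by
      ext m n
      fin_cases m <;> fin_cases n <;>
        simp [asdForm, Matrix.sum_apply, Finset.sum_apply]
    simp only [hr, hx, hlin, Matrix.mul_sum, Matrix.mul_smul]
  have hswap : ∀ c d, r d c = -r c d := by
    intro c d
    simp only [hr]
    rw [Finset.sum_comm, ← Finset.sum_neg_distrib]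
    refine Finset.sum_congr rfl fun i _ => ?_
    rw [← Finset.sum_neg_distrib]
    refine Finset.sum_congr rfl fun j _ => ?_
    rw [curvMat_swap i j, Matrix.mul_neg, Matrix.neg_mul, smul_neg, mul_comm]
  have hentry : ∀ a b c d, r c d a b
      = ∑ k, F z a k * ∑ i, ∑ j, ∑ l, E z i c * E z j d * E z l b * riemann g k l i j z := by
    intro a b c d
    have e : ∀ i j, (F z * curvMat g i j z * E z) a b
        = ∑ k, ∑ l, F z a k * E z l b * riemann g k l i j z := by
      intro i j
      simp only [Matrix.mul_apply, curvMat, Matrix.of_apply, Finset.sum_mul]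
      rw [Finset.sum_comm]
      exact Finset.sum_congr rfl fun k _ => Finset.sum_congr rfl fun l _ => by ring
    simp only [hr, Matrix.sum_apply, Matrix.smul_apply, e, smul_eq_mul, Finset.mul_sum]
    rw [Finset.sum_comm_cycle]
    refine Finset.sum_congr rfl fun k _ => Finset.sum_congr rfl fun i _ =>
      Finset.sum_congr rfl fun j _ => Finset.sum_congr rfl fun l _ => by ring
  have hb : ∀ a b c d, r c d a b + r d b a c + r b c a d = 0 := by
    intro a b c d
    simp only [hentry]
    rw [← Finset.sum_add_distrib, ← Finset.sum_add_distrib]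
    refine Finset.sum_eq_zero fun k _ => ?_
    rw [← mul_add, ← mul_add]
    have := cyclic_sum_contract (E z) (N := fun i j l => riemann g k l i j z)
      (fun i j l => by linear_combination riemann_bianchi hg k l i j z) c d b
    rw [this, mul_zero]
  have hric := sum_eq_zero_of_bianchi hrasd hswap hb
  have hRic : (Matrix.of fun l j => ricci g l j z) = 0 := by
    refine congruence_cancel hEF ?_
    ext b d
    rw [Matrix.zero_apply, ← hric b d]
    set Y : Fin 4 → Fin 4 → ℂ :=
      fun k i => ∑ j, ∑ l, E z j d * E z l b * riemann g k l i j z with hY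
    have h1 : ((E z)ᵀ * (Matrix.of fun l j => ricci g l j z) * E z) b d = ∑ k, Y k k := by
      simp only [Matrix.mul_apply, Matrix.transpose_apply, Matrix.of_apply, ricci, hY,
        Finset.mul_sum, Finset.sum_mul]
      rw [Finset.sum_comm_cycle]
      exact Finset.sum_congr rfl fun k _ => Finset.sum_congr rfl fun j _ =>
        Finset.sum_congr rfl fun l _ => by ring
    have h2 : ∑ a, r a d a b = ∑ k, ∑ i, (E z * F z) i k * Y k i := by
      simp only [hentry, Matrix.mul_apply, hY]
      rw [Finset.sum_comm]
      refine Finset.sum_congr rfl fun k _ => ?_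
      simp only [Finset.mul_sum, Finset.sum_mul]
      rw [Finset.sum_comm]
      refine Finset.sum_congr rfl fun i _ => ?_
      symm
      rw [Finset.sum_comm_cycle]
      exact Finset.sum_congr rfl fun a _ => Finset.sum_congr rfl fun j _ =>
        Finset.sum_congr rfl fun l _ => by ring
    rw [h1, h2, hEF]
    simp [Matrix.one_apply]
  exact congrFun (congrFun hRic l) j

end IsHyperkahlerFrame

theorem sum_sum_mul_mul (A B P : Matrix (Fin 4) (Fin 4) ℂ) (a b : Fin 4) :
    ∑ m, ∑ n, A a m * B b n * P m n = (A * P * Bᵀ) a b := by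
  simp only [Matrix.mul_apply, Matrix.transpose_apply, Finset.sum_mul]
  rw [Finset.sum_comm]
  exact Finset.sum_congr rfl fun n _ => Finset.sum_congr rfl fun m _ => by ring

theorem alternating_expand_last_two (D : (Fin 4 → ℂ) [⋀^Fin 4]→ₗ[ℂ] ℂ)
    (u v w t : Fin 4 → ℂ) :
    D ![u, v, w, t] = ∑ a, ∑ b, w a * t b * D ![u, v, basisVec a, basisVec b] := by
  have hsum : ∀ x : Fin 4 → ℂ, ∑ a, x a • basisVec a = x := fun x => by
    ext i
    simp [basisVec, Finset.sum_apply, Pi.single_apply]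
  have h2 : ∀ y, D ![u, v, w, y] = ∑ a, w a * D ![u, v, basisVec a, y] := by
    intro y
    have hupd : ∀ x : Fin 4 → ℂ, Function.update ![u, v, 0, y] 2 x = ![u, v, x, y] := by
      intro x
      ext i
      fin_cases i <;> simp
    have h := D.map_update_sum Finset.univ 2 (fun a => w a • basisVec a) ![u, v, 0, y]
    simp only [hsum, D.map_update_smul, smul_eq_mul] at h
    simpa only [hupd] using h
  have h3 : ∀ x, D ![u, v, x, t] = ∑ b, t b * D ![u, v, x, basisVec b] := by
    intro x
    have hupd : ∀ y : Fin 4 → ℂ, Function.update ![u, v, x, 0] 3 y = ![u, v, x, y] := by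
      intro y
      ext i
      fin_cases i <;> simp
    have h := D.map_update_sum Finset.univ 3 (fun a => t a • basisVec a) ![u, v, x, 0]
    simp only [hsum, D.map_update_smul, smul_eq_mul] at h
    simpa only [hupd] using h
  simp only [h2, h3 (basisVec _), Finset.mul_sum, mul_assoc]

/-- Multilinearity of the determinant in the last two rows. -/
theorem det_expand_last_two (u v w t : Fin 4 → ℂ) :
    Matrix.det (Matrix.of ![u, v, w, t])
      = ∑ a, ∑ b, w a * t b * Matrix.det (Matrix.of ![u, v, basisVec a, basisVec b]) := by
  have hof : ∀ x : Fin 4 → Fin 4 → ℂ, Matrix.det (Matrix.of x) = Matrix.detRowAlternating x :=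
    fun _ => rfl
  simp only [hof]
  exact alternating_expand_last_two Matrix.detRowAlternating u v w t

theorem sum_mul_contract (E Y : Matrix (Fin 4) (Fin 4) ℂ) (D : Fin 4 → Fin 4 → ℂ) :
    ∑ a, ∑ b, D a b * ∑ c, ∑ d, E a c * E b d * Y c d
      = ∑ c, ∑ d, (∑ a, ∑ b, E a c * E b d * D a b) * Y c d := by
  simp only [Finset.mul_sum, Finset.sum_mul]
  rw [Finset.sum_comm_cycle]
  refine Finset.sum_congr rfl fun c _ => ?_
  rw [Finset.sum_comm_cycle]
  exact Finset.sum_congr rfl fun d _ => Finset.sum_congr rfl fun a _ =>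
    Finset.sum_congr rfl fun b _ => by ring

namespace IsHyperkahlerFrame

variable {g F E : C4 → Matrix (Fin 4) (Fin 4) ℂ} {V : Set C4}

/-- A metric with a hyperkähler frame is anti-self-dual for the orientation in which
`(W, W̃, Z, Z̃)`, that is the columns `0, 2, 1, 3` of `E`, has volume one. -/
theorem hodgeStar_weyl (h : IsHyperkahlerFrame g F E V) (hg : ∀ z, (g z).IsSymm) (hV : IsOpen V)
    {ρ : C4 → ℂ} {z : C4} (hz : z ∈ V) (hρ : ρ z * (E z).det = -1) (i j k l : Fin 4) :
    hodgeStar g ρ z (fun m n => weyl g m n k l z) i j = -weyl g i j k l z := by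
  have hFE := h.mul_eq_one z hz
  have hEF := h.mul_eq_one' hz
  have hweyl : ∀ i j, weyl g i j k l z = (g z * curvMat g k l z) i j := by
    intro i j
    simp only [weyl, scalarCurv, h.ricci_eq_zero hg hV hz, mul_zero, sub_zero, add_zero,
      Finset.sum_const_zero, zero_mul, Matrix.mul_apply, riemannLow, curvMat, Matrix.of_apply]
  obtain ⟨x, hx⟩ := h.curvMat_asd hg hV hz k l
  have hP : g z * curvMat g k l z = (F z)ᵀ * asdForm x * F z := by
    calc g z * curvMat g k l z
        = (F z)ᵀ * nullGram * F z * curvMat g k l z * (E z * F z) := by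
          rw [hEF, Matrix.mul_one, h.metric_eq z hz]
      _ = (F z)ᵀ * nullGram * (F z * curvMat g k l z * E z) * F z := by
          simp only [Matrix.mul_assoc]
      _ = (F z)ᵀ * (nullGram * nullGram) * asdForm x * F z := by
          rw [hx]; simp only [Matrix.mul_assoc]
      _ = _ := by rw [nullGram_mul_self, Matrix.mul_one]
  simp only [hweyl, hP]
  set P := (F z)ᵀ * asdForm x * F z with hPdef
  set Y := nullGram * asdForm x * nullGram with hY
  -- both indices raised
  have hraise : ∀ a b, ∑ m, ∑ n, (g z)⁻¹ a m * (g z)⁻¹ b n * P m n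
      = ∑ c, ∑ d, E z a c * E z b d * Y c d := by
    intro a b
    rw [sum_sum_mul_mul, sum_sum_mul_mul, h.inv_eq hz]
    refine congrFun (congrFun ?_ a) b
    have hEFt : (E z)ᵀ * (F z)ᵀ = 1 := by
      rw [← Matrix.transpose_mul, hFE, Matrix.transpose_one]
    calc E z * nullGram * (E z)ᵀ * P * (E z * nullGram * (E z)ᵀ)ᵀ
        = E z * nullGram * ((E z)ᵀ * (F z)ᵀ) * asdForm x * (F z * E z) * nullGram * (E z)ᵀ := by
          simp only [hPdef, Matrix.transpose_mul, Matrix.transpose_transpose, nullGram_transpose,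
            Matrix.mul_assoc]
      _ = E z * Y * (E z)ᵀ := by
          rw [hEFt, hFE, Matrix.mul_one, Matrix.mul_one]
          simp only [hY, Matrix.mul_assoc]
  -- the volume form on two coordinate vectors and two frame vectors
  have hdet : ∀ c d : Fin 4, Matrix.det (Matrix.of ![basisVec i, basisVec j,
      fun a => E z a c, fun a => E z a d]) = Matrix.det (Matrix.of ![fun m => F z m i,
        fun m => F z m j, Pi.single c 1, Pi.single d 1]) * (E z).det := by
    intro c d
    have hδ : ∀ a b, ∑ m, E z a m * F z m b = (1 : Matrix (Fin 4) (Fin 4) ℂ) a b := fun a b => by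
      rw [← hEF, Matrix.mul_apply]
    rw [← Matrix.det_transpose (E z), ← Matrix.det_mul]
    congr 1
    ext m n
    fin_cases m
    · simpa [Matrix.mul_apply, basisVec, Matrix.one_apply, Pi.single_apply, mul_comm]
        using (hδ n i).symm
    · simpa [Matrix.mul_apply, basisVec, Matrix.one_apply, Pi.single_apply, mul_comm]
        using (hδ n j).symm
    · simp [Matrix.mul_apply, Pi.single_apply]
    · simp [Matrix.mul_apply, Pi.single_apply]
  have hexp : ∀ c d, Matrix.det (Matrix.of ![basisVec i, basisVec j,
      fun a => E z a c, fun a => E z a d]) = ∑ a, ∑ b, E z a c * E z b d *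
        Matrix.det (Matrix.of ![basisVec i, basisVec j, basisVec a, basisVec b]) :=
    fun c d => det_expand_last_two _ _ _ _
  calc hodgeStar g ρ z P i j
      = (1 / 2) * ρ z * ∑ a, ∑ b,
          Matrix.det (Matrix.of ![basisVec i, basisVec j, basisVec a, basisVec b])
            * ∑ m, ∑ n, (g z)⁻¹ a m * (g z)⁻¹ b n * P m n := by
        simp only [hodgeStar, fourForm, Finset.mul_sum]
        exact Finset.sum_congr rfl fun a _ => Finset.sum_congr rfl fun b _ =>
          Finset.sum_congr rfl fun m _ => Finset.sum_congr rfl fun n _ => by ring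
    _ = (1 / 2) * ρ z * ∑ c, ∑ d, Matrix.det (Matrix.of ![basisVec i, basisVec j,
          fun a => E z a c, fun a => E z a d]) * Y c d := by
        simp only [hraise, hexp]
        rw [sum_mul_contract (E z) Y fun a b =>
          Matrix.det (Matrix.of ![basisVec i, basisVec j, basisVec a, basisVec b])]
    _ = (1 / 2) * (ρ z * (E z).det) * ∑ c, ∑ d, Matrix.det (Matrix.of ![fun m => F z m i,
          fun m => F z m j, Pi.single c 1, Pi.single d 1]) * Y c d := by
        simp only [hdet, Finset.mul_sum]
        exact Finset.sum_congr rfl fun c _ => Finset.sum_congr rfl fun d _ => by ring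
    _ = -P i j := by
        have hPij : P i j = (fun m => F z m i) ⬝ᵥ (asdForm x *ᵥ fun m => F z m j) := by
          rw [hPdef, Matrix.mul_assoc]
          rfl
        rw [asdForm_dual, hρ, hPij]
        ring

end IsHyperkahlerFrame

/-! ### The tetrad of the general heavenly equation -/

/-- The matrix whose columns are the tetrad `(W, Z, W̃, Z̃)`. -/
noncomputable def tetradMat (b c : ℂ) (s u : C4 → ℂ) (z : C4) : Matrix (Fin 4) (Fin 4) ℂ :=
  Matrix.of fun i a => tetrad b c s u z a i

/-- The matrix whose rows are the 1-forms `ω¹, ω², ω³, ω⁴`. -/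
noncomputable def coframeMat (b c : ℂ) (s u : C4 → ℂ) (z : C4) : Matrix (Fin 4) (Fin 4) ℂ :=
  Matrix.of fun a i => coframe b c s u z (basisVec i) a

/-- The closed 2-form `dzⁱ ∧ d(∂u/∂zⁱ)`. -/
noncomputable def sigma (u : C4 → ℂ) (i : Fin 4) (z : C4) : Matrix (Fin 4) (Fin 4) ℂ :=
  Matrix.of fun a b => basisVec i a * d2 u i b z - basisVec i b * d2 u i a z

theorem tetradMat_eq (b c : ℂ) (s u : C4 → ℂ) (z : C4) :
    tetradMat b c s u z =
      !![1 / (b * c * s z) * d2 u 2 3 z, 0, 0, -(c / (b * s z) * d2 u 2 3 z);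
        0, -(1 / (b * c * s z) * d2 u 2 3 z), -(b / (c * s z) * d2 u 2 3 z), 0;
        0, 0, b / (c * s z) * d2 u 1 3 z, c / (b * s z) * d2 u 0 3 z;
        -(1 / (b * c * s z) * d2 u 0 2 z), 1 / (b * c * s z) * d2 u 1 2 z, 0, 0] := by
  ext i a
  fin_cases i <;> fin_cases a <;>
    simp [tetradMat, tetrad, fieldW, fieldZ, fieldW', fieldZ', basisVec]

theorem coframeMat_eq (b c : ℂ) (s u : C4 → ℂ) (z : C4) :
    coframeMat b c s u z =
      !![-(b * c / s z) * (d2 u 1 2 z * d2 u 0 3 z), -(b * c / s z) * (d2 u 1 2 z * d2 u 1 3 z),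
          -(b * c / s z) * (d2 u 2 3 z * d2 u 1 2 z), -(b * c / s z) * (d2 u 2 3 z * d2 u 1 3 z);
        -(b * c / s z) * (d2 u 0 2 z * d2 u 0 3 z), -(b * c / s z) * (d2 u 0 2 z * d2 u 1 3 z),
          -(b * c / s z) * (d2 u 2 3 z * d2 u 0 2 z), -(b * c / s z) * (d2 u 2 3 z * d2 u 0 3 z);
        c / (b * s z) * (d2 u 0 3 z * d2 u 0 2 z), c / (b * s z) * (d2 u 0 3 z * d2 u 1 2 z),
          c / (b * s z) * (d2 u 2 3 z * d2 u 0 2 z), c / (b * s z) * (d2 u 2 3 z * d2 u 0 3 z);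
        -(b / (c * s z)) * (d2 u 1 3 z * d2 u 0 2 z), -(b / (c * s z)) * (d2 u 1 3 z * d2 u 1 2 z),
          -(b / (c * s z)) * (d2 u 2 3 z * d2 u 1 2 z),
          -(b / (c * s z)) * (d2 u 2 3 z * d2 u 1 3 z)] := by
  ext a i
  fin_cases a <;> fin_cases i <;>
    simp [coframeMat, coframe, omega1, omega2, omega3, omega4, basisVec]

section Pointwise

variable {b c : ℂ} {s u : C4 → ℂ} {z : C4}

/-- The coframe is dual to the tetrad. -/
theorem coframeMat_mul_tetradMat (hb : b ≠ 0) (hc : c ≠ 0) (h34 : d2 u 2 3 z ≠ 0)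
    (hΔ : Delta u z ≠ 0) (hs : s z ^ 2 = d2 u 2 3 z * Delta u z) :
    coframeMat b c s u z * tetradMat b c s u z = 1 := by
  have hs0 : s z ≠ 0 := fun h => mul_ne_zero h34 hΔ (by rw [← hs, h]; ring)
  rw [Delta] at hs
  rw [coframeMat_eq, tetradMat_eq]
  ext i j
  fin_cases i <;> fin_cases j <;>
    simp only [Matrix.mul_apply, Fin.sum_univ_four] <;> simp <;> field_simp <;>
    first | ring1 | linear_combination hs | linear_combination -hs

/-- The metric is `2 (ω² ω⁴ - ω¹ ω³)`, by the heavenly equation. -/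
theorem coframeMat_gram (hb : b ≠ 0) (hc : c ≠ 0) (hbc : b ^ 2 + c ^ 2 ≠ 0)
    (h34 : d2 u 2 3 z ≠ 0) (hΔ : Delta u z ≠ 0) (hs : s z ^ 2 = d2 u 2 3 z * Delta u z)
    (hsol : (b ^ 2 + c ^ 2) * d2 u 0 1 z * d2 u 2 3 z
      = b ^ 2 * d2 u 0 2 z * d2 u 1 3 z + c ^ 2 * d2 u 0 3 z * d2 u 1 2 z) :
    metric (b ^ 2) (c ^ 2) u z = (coframeMat b c s u z)ᵀ * nullGram * coframeMat b c s u z := by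
  have hs0 : s z ≠ 0 := fun h => mul_ne_zero h34 hΔ (by rw [← hs, h]; ring)
  have h12 : d2 u 0 1 z = (b ^ 2 * d2 u 0 2 z * d2 u 1 3 z + c ^ 2 * d2 u 0 3 z * d2 u 1 2 z)
      / ((b ^ 2 + c ^ 2) * d2 u 2 3 z) := by
    rw [eq_div_iff (mul_ne_zero hbc h34), ← hsol]
    ring
  rw [coframeMat_eq, metric, h12]
  generalize Delta u z = D at *
  generalize d2 u 0 2 z = p13 at *
  generalize d2 u 0 3 z = p14 at *
  generalize d2 u 1 2 z = p23 at *
  generalize d2 u 1 3 z = p24 at *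
  generalize d2 u 2 3 z = p34 at *
  generalize s z = t at *
  ext i j
  fin_cases i <;> fin_cases j <;>
    simp only [Matrix.mul_apply, Fin.sum_univ_four] <;> simp [nullGram] <;> field_simp <;>
    rw [hs] <;> ring1

theorem tetradMat_sigma_two (hb : b ≠ 0) (hc : c ≠ 0) (h34 : d2 u 2 3 z ≠ 0)
    (hΔ : Delta u z ≠ 0) (hs : s z ^ 2 = d2 u 2 3 z * Delta u z)
    (hsymm : ∀ i j, d2 u i j z = d2 u j i z) :
    (tetradMat b c s u z)ᵀ * sigma u 2 z * tetradMat b c s u z = -sdForm 0 := by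
  have hs0 : s z ≠ 0 := fun h => mul_ne_zero h34 hΔ (by rw [← hs, h]; ring)
  have h2 : sigma u 2 z = !![0, 0, -d2 u 0 2 z, 0; 0, 0, -d2 u 1 2 z, 0;
      d2 u 0 2 z, d2 u 1 2 z, 0, d2 u 2 3 z; 0, 0, -d2 u 2 3 z, 0] := by
    ext i j
    fin_cases i <;> fin_cases j <;> simp [sigma, basisVec, hsymm 2 0, hsymm 2 1]
  rw [Delta] at hs
  rw [tetradMat_eq, h2]
  ext i j
  fin_cases i <;> fin_cases j <;>
    simp only [Matrix.mul_apply, Fin.sum_univ_four] <;> simp [sdForm] <;> field_simp <;>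
    first | exact Or.inl (by ring1) | exact Or.inr (by ring1) | ring1 | linear_combination hs |
      linear_combination -hs

theorem tetradMat_sigma_three (hb : b ≠ 0) (hc : c ≠ 0) (h34 : d2 u 2 3 z ≠ 0)
    (hΔ : Delta u z ≠ 0) (hs : s z ^ 2 = d2 u 2 3 z * Delta u z)
    (hsymm : ∀ i j, d2 u i j z = d2 u j i z) :
    (tetradMat b c s u z)ᵀ * ((b ^ 2 * c ^ 2) • sigma u 3 z) * tetradMat b c s u z
      = sdForm 1 := by
  have hs0 : s z ≠ 0 := fun h => mul_ne_zero h34 hΔ (by rw [← hs, h]; ring)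
  have h3 : sigma u 3 z = !![0, 0, 0, -d2 u 0 3 z; 0, 0, 0, -d2 u 1 3 z;
      0, 0, 0, -d2 u 2 3 z; d2 u 0 3 z, d2 u 1 3 z, d2 u 2 3 z, 0] := by
    ext i j
    fin_cases i <;> fin_cases j <;> simp [sigma, basisVec, hsymm 3 0, hsymm 3 1, hsymm 3 2]
  rw [Delta] at hs
  rw [tetradMat_eq, h3]
  ext i j
  fin_cases i <;> fin_cases j <;>
    simp only [Matrix.mul_apply, Fin.sum_univ_four] <;> simp [sdForm] <;> field_simp <;>
    first | exact Or.inl (by ring1) | exact Or.inr (by ring1) | ring1 | linear_combination hs |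
      linear_combination -hs

/-- The components of `dz¹ ∧ d(∂u/∂z¹)` in the tetrad, which the heavenly equation makes constant;
the factor `b ^ 2 * c ^ 2` clears denominators. -/
theorem tetradMat_sigma_zero (hb : b ≠ 0) (hc : c ≠ 0)
    (h34 : d2 u 2 3 z ≠ 0) (hΔ : Delta u z ≠ 0) (hs : s z ^ 2 = d2 u 2 3 z * Delta u z)
    (hsol : (b ^ 2 + c ^ 2) * d2 u 0 1 z * d2 u 2 3 z
      = b ^ 2 * d2 u 0 2 z * d2 u 1 3 z + c ^ 2 * d2 u 0 3 z * d2 u 1 2 z) :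
    (b ^ 2 * c ^ 2) • ((tetradMat b c s u z)ᵀ * ((b ^ 2 + c ^ 2) • sigma u 0 z)
      * tetradMat b c s u z)
      = (b ^ 2 * c ^ 2) • sdForm 2 - b ^ 2 • sdForm 1 + (b ^ 2 * c ^ 4) • sdForm 0 := by
  have hs0 : s z ≠ 0 := fun h => mul_ne_zero h34 hΔ (by rw [← hs, h]; ring)
  have h0 : sigma u 0 z = !![0, d2 u 0 1 z, d2 u 0 2 z, d2 u 0 3 z; -d2 u 0 1 z, 0, 0, 0;
      -d2 u 0 2 z, 0, 0, 0; -d2 u 0 3 z, 0, 0, 0] := by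
    ext i j
    fin_cases i <;> fin_cases j <;> simp [sigma, basisVec]
  rw [Delta] at hs
  rw [tetradMat_eq, h0]
  ext i j
  fin_cases i <;> fin_cases j <;>
    simp only [Matrix.mul_apply, Matrix.smul_apply, Matrix.add_apply, Matrix.sub_apply,
      Fin.sum_univ_four] <;> simp [sdForm] <;> field_simp <;>
    first
    | exact Or.inl (by ring1)
    | exact Or.inr (by ring1)
    | ring1
    | linear_combination -d2 u 2 3 z * hsol + b ^ 2 * hs
    | linear_combination d2 u 2 3 z * hsol - b ^ 2 * hs
    | linear_combination -d2 u 2 3 z * hsol - c ^ 2 * hs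
    | linear_combination d2 u 2 3 z * hsol + c ^ 2 * hs

/-- The volume form `-βγΔ dz¹ ∧ dz² ∧ dz³ ∧ dz⁴` takes the value `-1` on `(W, Z, W̃, Z̃)`. -/
theorem det_tetradMat (hb : b ≠ 0) (hc : c ≠ 0) (h34 : d2 u 2 3 z ≠ 0)
    (hΔ : Delta u z ≠ 0) (hs : s z ^ 2 = d2 u 2 3 z * Delta u z) :
    -(b ^ 2 * c ^ 2 * Delta u z) * (tetradMat b c s u z).det = -1 := by
  have hs0 : s z ≠ 0 := fun h => mul_ne_zero h34 hΔ (by rw [← hs, h]; ring)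
  rw [tetradMat_eq]
  simp [Matrix.det_succ_row_zero, Fin.sum_univ_succ, Fin.succAbove]
  field_simp
  have hs4 : s z ^ 4 = (d2 u 2 3 z * Delta u z) ^ 2 := by rw [← hs]; ring
  rw [hs4, Delta]
  ring

/-- The closed 2-forms `dzⁱ ∧ d(∂u/∂zⁱ)` have constant components in the coframe, and span the
self-dual 2-forms. The heavenly equation is used only for the form with `i = 1`. -/
theorem coframeMat_sdForm (hb : b ≠ 0) (hc : c ≠ 0)
    (h34 : d2 u 2 3 z ≠ 0) (hΔ : Delta u z ≠ 0) (hs : s z ^ 2 = d2 u 2 3 z * Delta u z)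
    (hsol : (b ^ 2 + c ^ 2) * d2 u 0 1 z * d2 u 2 3 z
      = b ^ 2 * d2 u 0 2 z * d2 u 1 3 z + c ^ 2 * d2 u 0 3 z * d2 u 1 2 z)
    (hsymm : ∀ i j, d2 u i j z = d2 u j i z) :
    (coframeMat b c s u z)ᵀ * sdForm 0 * coframeMat b c s u z = -sigma u 2 z ∧
    (coframeMat b c s u z)ᵀ * sdForm 1 * coframeMat b c s u z
      = (b ^ 2 * c ^ 2) • sigma u 3 z ∧
    (coframeMat b c s u z)ᵀ * sdForm 2 * coframeMat b c s u z
      = (b ^ 2 + c ^ 2) • sigma u 0 z + b ^ 2 • sigma u 3 z + c ^ 2 • sigma u 2 z := by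
  have hFE := coframeMat_mul_tetradMat hb hc h34 hΔ hs
  have hEF := mul_eq_one_comm.mp hFE
  have hpull : ∀ S X, (tetradMat b c s u z)ᵀ * X * tetradMat b c s u z = S →
      (coframeMat b c s u z)ᵀ * S * coframeMat b c s u z = X := by
    intro S X h
    have hEFt : (coframeMat b c s u z)ᵀ * (tetradMat b c s u z)ᵀ = 1 := by
      rw [← Matrix.transpose_mul, hEF, Matrix.transpose_one]
    calc (coframeMat b c s u z)ᵀ * S * coframeMat b c s u z
        = ((coframeMat b c s u z)ᵀ * (tetradMat b c s u z)ᵀ) * X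
          * (tetradMat b c s u z * coframeMat b c s u z) := by
          rw [← h]; simp only [Matrix.mul_assoc]
      _ = X := by rw [hEFt, hEF, Matrix.one_mul, Matrix.mul_one]
  have h2 := tetradMat_sigma_two hb hc h34 hΔ hs hsymm
  have h3 := tetradMat_sigma_three hb hc h34 hΔ hs hsymm
  have h0 := tetradMat_sigma_zero hb hc h34 hΔ hs hsol
  have hbc0 : b ^ 2 * c ^ 2 ≠ 0 := mul_ne_zero (pow_ne_zero 2 hb) (pow_ne_zero 2 hc)
  refine ⟨hpull _ _ ?_, hpull _ _ h3, hpull _ _ ?_⟩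
  · rw [Matrix.mul_neg, Matrix.neg_mul, h2, neg_neg]
  · refine smul_right_injective _ hbc0 ?_
    simp only [Matrix.mul_smul, Matrix.smul_mul, Matrix.mul_add, Matrix.add_mul] at h0 h3 ⊢
    rw [h2, smul_add, smul_add, h0, smul_comm (b ^ 2 * c ^ 2) (b ^ 2), h3]
    module

end Pointwise

/-! ### The hyperkähler frame of a solution -/

section Solution

variable {u : C4 → ℂ} {z : C4}

theorem analyticAt_d2 (hu : AnalyticAt ℂ u z) (i j : Fin 4) : AnalyticAt ℂ (d2 u i j) z :=
  analyticAt_pd j (analyticAt_pd i hu)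

theorem analyticAt_Delta (hu : AnalyticAt ℂ u z) : AnalyticAt ℂ (Delta u) z :=
  ((analyticAt_d2 hu 0 2).mul (analyticAt_d2 hu 1 3)).sub
    ((analyticAt_d2 hu 0 3).mul (analyticAt_d2 hu 1 2))

theorem d2_symm (hu : AnalyticAt ℂ u z) (i j : Fin 4) : d2 u i j z = d2 u j i z :=
  pd_comm j i hu

theorem analyticAt_sigma (hu : AnalyticAt ℂ u z) (m i j : Fin 4) :
    AnalyticAt ℂ (fun w => sigma u m w i j) z :=
  (analyticAt_const.mul (analyticAt_d2 hu m j)).sub (analyticAt_const.mul (analyticAt_d2 hu m i))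

/-- The 2-form `dzᵐ ∧ d(∂u/∂zᵐ)` is closed. -/
theorem sigma_closed (hu : AnalyticAt ℂ u z) (m i j k : Fin 4) :
    pd i (fun w => sigma u m w j k) z + pd j (fun w => sigma u m w k i) z
      + pd k (fun w => sigma u m w i j) z = 0 := by
  have h : ∀ i j k, pd i (fun w => sigma u m w j k) z
      = basisVec m j * pd i (d2 u m k) z - basisVec m k * pd i (d2 u m j) z := by
    intro i j k
    have hd : ∀ j, DifferentiableAt ℂ (d2 u m j) z :=
      fun j => (analyticAt_d2 hu m j).differentiableAt
    change pd i (fun w => basisVec m j * d2 u m k w - basisVec m k * d2 u m j w) z = _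
    rw [pd_sub i ((hd k).const_mul _) ((hd j).const_mul _), pd_const_mul i _ (hd k),
      pd_const_mul i _ (hd j)]
  have hsymm : ∀ i j, pd i (d2 u m j) z = pd j (d2 u m i) z :=
    fun i j => pd_comm i j (analyticAt_pd m hu)
  rw [h, h, h, hsymm i k, hsymm i j, hsymm j k]
  ring

theorem analyticAt_smul_basisVec {f : C4 → ℂ} (hf : AnalyticAt ℂ f z) (i : Fin 4) :
    AnalyticAt ℂ (fun w => f w • basisVec i) z :=
  hf.smul analyticAt_const

/-- If `β + γ = 0`, the general heavenly equation reads `β Δ = 0`. -/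
theorem add_ne_zero_of_solves {β γ : ℂ} (hβ : β ≠ 0) {U : Set C4}
    (hsol : SolvesGeneralHeavenly β γ u U) (hz : z ∈ U) (hΔ : Delta u z ≠ 0) : β + γ ≠ 0 := by
  intro h
  have h1 := hsol z hz
  have h2 : γ = -β := by linear_combination h
  refine mul_ne_zero hβ hΔ ?_
  rw [Delta]
  rw [h2] at h1
  linear_combination -h1

theorem metric_isSymm (β γ : ℂ) (u : C4 → ℂ) (z : C4) : (metric β γ u z).IsSymm := by
  ext i j
  fin_cases i <;> fin_cases j <;> rfl

variable {b c : ℂ} {s : C4 → ℂ}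

theorem analyticAt_tetrad (hb : b ≠ 0) (hc : c ≠ 0) (hu : AnalyticAt ℂ u z)
    (hs : AnalyticAt ℂ s z) (hs0 : s z ≠ 0) (a : Fin 4) :
    AnalyticAt ℂ (fun w => tetrad b c s u w a) z := by
  have hd := analyticAt_d2 hu
  have h : ∀ (k l : ℂ) (i j m n p q : Fin 4), l ≠ 0 → AnalyticAt ℂ (fun w =>
      (k / (l * s w)) • (d2 u i j w • basisVec p - d2 u m n w • basisVec q)) z := by
    intro k l i j m n p q hl
    exact (analyticAt_const.div (analyticAt_const.mul hs) (mul_ne_zero hl hs0)).smul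
      ((analyticAt_smul_basisVec (hd i j) p).sub (analyticAt_smul_basisVec (hd m n) q))
  fin_cases a
  · exact h 1 (b * c) 2 3 0 2 0 3 (mul_ne_zero hb hc)
  · exact h 1 (b * c) 1 2 2 3 3 1 (mul_ne_zero hb hc)
  · exact h b c 1 3 2 3 2 1 hc
  · exact h c b 0 3 2 3 2 0 hb

theorem analyticAt_coframeMat (hb : b ≠ 0) (hc : c ≠ 0) (hu : AnalyticAt ℂ u z)
    (hs : AnalyticAt ℂ s z) (hs0 : s z ≠ 0) (a i : Fin 4) :
    AnalyticAt ℂ (fun w => coframeMat b c s u w a i) z := by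
  have hd := analyticAt_d2 hu
  have h : ∀ (k l : ℂ) (i j m n : Fin 4), l ≠ 0 → AnalyticAt ℂ (fun w =>
      k / (l * s w) * (d2 u i j w * d2 u m n w)) z := by
    intro k l i j m n hl
    exact (analyticAt_const.div (analyticAt_const.mul hs) (mul_ne_zero hl hs0)).mul
      ((hd i j).mul (hd m n))
  have h' : ∀ (k l : ℂ) (i j m n : Fin 4), l ≠ 0 → AnalyticAt ℂ (fun w =>
      -(k / (l * s w)) * (d2 u i j w * d2 u m n w)) z := by
    intro k l i j m n hl
    simp only [neg_mul]
    exact (h k l i j m n hl).fun_neg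
  have h1 : ∀ (i j m n : Fin 4), AnalyticAt ℂ (fun w =>
      -(b * c / s w) * (d2 u i j w * d2 u m n w)) z := by
    intro i j m n
    simpa only [one_mul] using h' (b * c) 1 i j m n one_ne_zero
  simp only [coframeMat_eq]
  fin_cases a <;> fin_cases i <;>
    first | exact h1 _ _ _ _ | exact h _ _ _ _ _ _ hb | exact h' _ _ _ _ _ _ hc

/-- The tetrad and coframe of a solution of the general heavenly equation form a hyperkähler
frame. -/
theorem isHyperkahlerFrame (hb : b ≠ 0) (hc : c ≠ 0) {V : Set C4} (hV : IsOpen V)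
    (hu : AnalyticOnNhd ℂ u V) (hsol : SolvesGeneralHeavenly (b ^ 2) (c ^ 2) u V)
    (h34 : ∀ z ∈ V, d2 u 2 3 z ≠ 0) (hΔ : ∀ z ∈ V, Delta u z ≠ 0)
    (hs : AnalyticOnNhd ℂ s V) (hs2 : ∀ z ∈ V, s z ^ 2 = d2 u 2 3 z * Delta u z) :
    IsHyperkahlerFrame (metric (b ^ 2) (c ^ 2) u) (coframeMat b c s u) (tetradMat b c s u) V := by
  have hs0 : ∀ z ∈ V, s z ≠ 0 := fun z hz h =>
    mul_ne_zero (h34 z hz) (hΔ z hz) (by rw [← hs2 z hz, h]; ring)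
  refine ⟨fun i j z hz => analyticAt_coframeMat hb hc (hu z hz) (hs z hz) (hs0 z hz) i j,
    fun i j z hz => ?_,
    fun z hz => coframeMat_mul_tetradMat hb hc (h34 z hz) (hΔ z hz) (hs2 z hz),
    fun z hz => coframeMat_gram hb hc
      (add_ne_zero_of_solves (pow_ne_zero 2 hb) hsol hz (hΔ z hz)) (h34 z hz) (hΔ z hz)
      (hs2 z hz) (hsol z hz), fun m z hz i j k => ?_⟩
  · exact ((ContinuousLinearMap.proj (R := ℂ) (φ := fun _ : Fin 4 => ℂ) i).analyticAt _).comp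
      (analyticAt_tetrad hb hc (hu z hz) (hs z hz) (hs0 z hz) j)
  · have hform : ∀ w ∈ V, _ := fun w hw => coframeMat_sdForm hb hc (h34 w hw) (hΔ w hw)
      (hs2 w hw) (hsol w hw) (d2_symm (hu w hw))
    -- each of the three 2-forms is a constant combination of the closed forms `sigma u m`
    have hcomb : ∃ p q r : ℂ, ∀ w ∈ V,
        (coframeMat b c s u w)ᵀ * sdForm m * coframeMat b c s u w
          = p • sigma u 0 w + q • sigma u 3 w + r • sigma u 2 w := by
      fin_cases m
      · exact ⟨0, 0, -1, fun w hw => (hform w hw).1.trans (by module)⟩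
      · exact ⟨0, b ^ 2 * c ^ 2, 0, fun w hw => (hform w hw).2.1.trans (by module)⟩
      · exact ⟨_, _, _, fun w hw => (hform w hw).2.2⟩
    obtain ⟨p, q, r, hpqr⟩ := hcomb
    have hpd : ∀ i j k,
        pd i (fun w => ((coframeMat b c s u w)ᵀ * sdForm m * coframeMat b c s u w) j k) z
          = p * pd i (fun w => sigma u 0 w j k) z + q * pd i (fun w => sigma u 3 w j k) z
            + r * pd i (fun w => sigma u 2 w j k) z := by
      intro i j k
      have hd : ∀ n, DifferentiableAt ℂ (fun w => sigma u n w j k) z :=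
        fun n => (analyticAt_sigma (hu z hz) n j k).differentiableAt
      have heq : (fun w => ((coframeMat b c s u w)ᵀ * sdForm m * coframeMat b c s u w) j k)
          =ᶠ[𝓝 z] fun w => p * sigma u 0 w j k + q * sigma u 3 w j k + r * sigma u 2 w j k := by
        filter_upwards [hV.mem_nhds hz] with w hw
        rw [hpqr w hw]
        rfl
      rw [pd_congr heq, pd_add i (((hd 0).const_mul p).fun_add ((hd 3).const_mul q))
        ((hd 2).const_mul r), pd_add i ((hd 0).const_mul p) ((hd 3).const_mul q),
        pd_const_mul i p (hd 0), pd_const_mul i q (hd 3), pd_const_mul i r (hd 2)]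
    rw [hpd, hpd, hpd]
    have hcl := fun n => sigma_closed (hu z hz) n i j k
    linear_combination p * hcl 0 + q * hcl 3 + r * hcl 2

theorem coframe_eq_mulVec (b c : ℂ) (s u : C4 → ℂ) (z v : C4) :
    coframe b c s u z v = coframeMat b c s u z *ᵥ v := by
  rw [coframeMat_eq]
  ext a
  fin_cases a <;>
    simp [coframe, omega1, omega2, omega3, omega4, Matrix.mulVec, dotProduct,
      Fin.sum_univ_four] <;> ring

end Solution

/-- A nowhere vanishing holomorphic function locally has a holomorphic square root. -/
theorem exists_local_sqrt {f : C4 → ℂ} {U : Set C4} (hU : IsOpen U) (hf : AnalyticOnNhd ℂ f U)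
    {z₀ : C4} (hz₀ : z₀ ∈ U) (h0 : f z₀ ≠ 0) :
    ∃ V : Set C4, IsOpen V ∧ z₀ ∈ V ∧ V ⊆ U ∧ ∃ s : C4 → ℂ,
      AnalyticOnNhd ℂ s V ∧ ∀ z ∈ V, s z ^ 2 = f z := by
  obtain ⟨r, hr⟩ := IsAlgClosed.exists_pow_nat_eq (f z₀) two_pos
  -- on `V` the quotient `f / f z₀` stays off the branch cut of the principal root
  have hq : AnalyticOnNhd ℂ (fun z => f z / f z₀) U := fun z hz => (hf z hz).div_const
  refine ⟨U ∩ (fun z => f z / f z₀) ⁻¹' Complex.slitPlane,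
    hq.continuousOn.isOpen_inter_preimage hU Complex.isOpen_slitPlane,
    ⟨hz₀, by simp [h0]⟩, Set.inter_subset_left,
    fun z => r * (f z / f z₀) ^ ((2 : ℂ)⁻¹),
    fun z hz => analyticAt_const.mul ((hq z hz.1).cpow analyticAt_const hz.2), fun z hz => ?_⟩
  rw [mul_pow, hr, Complex.cpow_ofNat_inv_pow]
  field_simp

end Heavenly

theorem mainTheorem3 (β γ : ℂ) (hβ : β ≠ 0) (hγ : γ ≠ 0) (U : Set C4) (hU : IsOpen U)
    (u : C4 → ℂ) (hu : AnalyticOnNhd ℂ u U)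
    (hsol : SolvesGeneralHeavenly β γ u U)
    (hu34 : ∀ z ∈ U, d2 u 2 3 z ≠ 0) (hΔ : ∀ z ∈ U, Delta u z ≠ 0) :
    -- the metric, in terms of `u` alone, and its orientation
    (IsHolomorphicMetric (metric β γ u) U ∧
      (∀ z ∈ U, ∀ v : C4, inner2 (metric β γ u) z v v = lineElement β γ u z v) ∧
      IsMetricVolume (metric β γ u) (fun z => -(β * γ * Delta u z)) U ∧
      IsAntiSelfDual (metric β γ u) (fun z => -(β * γ * Delta u z)) U ∧
      IsRicciFlat (metric β γ u) U) ∧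
    -- the square root in the tetrad exists locally
    (∀ z₀ ∈ U, ∃ V : Set C4, IsOpen V ∧ z₀ ∈ V ∧ V ⊆ U ∧ ∃ s : C4 → ℂ,
      AnalyticOnNhd ℂ s V ∧ ∀ z ∈ V, s z ^ 2 = d2 u 2 3 z * Delta u z) ∧
    -- the tetrad, coframe and metric, for every choice of the square roots
    (∀ (b c : ℂ), b ^ 2 = β → c ^ 2 = γ →
      ∀ (V : Set C4), IsOpen V → V ⊆ U →
      ∀ s : C4 → ℂ, AnalyticOnNhd ℂ s V → (∀ z ∈ V, s z ^ 2 = d2 u 2 3 z * Delta u z) →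
        IsNullTetrad (metric β γ u) (fieldW b c s u) (fieldZ b c s u)
          (fieldW' b c s u) (fieldZ' b c s u) V ∧
        (∀ z ∈ V, fourForm (fun w => -(β * γ * Delta u w)) z (fieldW b c s u z)
          (fieldW' b c s u z) (fieldZ b c s u z) (fieldZ' b c s u z) = 1) ∧
        (∀ z ∈ V, ∀ i j : Fin 4,
          coframe b c s u z (tetrad b c s u z j) i = if i = j then 1 else 0) ∧
        (∀ z ∈ V, ∀ v : C4,
          2 * (omega2 b c s u z v * omega4 b c s u z v - omega1 b c s u z v * omega3 b c s u z v)
            = lineElement β γ u z v)) := by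
  have hsqrt : ∀ z₀ ∈ U, ∃ V : Set C4, IsOpen V ∧ z₀ ∈ V ∧ V ⊆ U ∧ ∃ s : C4 → ℂ,
      AnalyticOnNhd ℂ s V ∧ ∀ z ∈ V, s z ^ 2 = d2 u 2 3 z * Delta u z := fun z₀ hz₀ =>
    exists_local_sqrt hU
      (fun z hz => (analyticAt_d2 (hu z hz) 2 3).mul (analyticAt_Delta (hu z hz)))
      hz₀ (mul_ne_zero (hu34 z₀ hz₀) (hΔ z₀ hz₀))
  have hframe : ∀ (b c : ℂ), b ^ 2 = β → c ^ 2 = γ → ∀ (V : Set C4), IsOpen V → V ⊆ U →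
      ∀ s : C4 → ℂ, AnalyticOnNhd ℂ s V → (∀ z ∈ V, s z ^ 2 = d2 u 2 3 z * Delta u z) →
      b ≠ 0 ∧ c ≠ 0 ∧
        IsHyperkahlerFrame (metric β γ u) (coframeMat b c s u) (tetradMat b c s u) V := by
    rintro b c rfl rfl V hV hVU s hs hs2
    have hb : b ≠ 0 := by rintro rfl; simp at hβ
    have hc : c ≠ 0 := by rintro rfl; simp at hγ
    exact ⟨hb, hc, isHyperkahlerFrame hb hc hV (hu.mono hVU) (fun z hz => hsol z (hVU hz))
      (fun z hz => hu34 z (hVU hz)) (fun z hz => hΔ z (hVU hz)) hs hs2⟩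
  have hlocal : ∀ z ∈ U, ∃ (b c : ℂ) (V : Set C4) (s : C4 → ℂ), b ^ 2 = β ∧ c ^ 2 = γ ∧
      IsOpen V ∧ z ∈ V ∧
      IsHyperkahlerFrame (metric β γ u) (coframeMat b c s u) (tetradMat b c s u) V ∧
      -(β * γ * Delta u z) * (tetradMat b c s u z).det = -1 := by
    intro z hz
    obtain ⟨b, hb⟩ := IsAlgClosed.exists_pow_nat_eq β two_pos
    obtain ⟨c, hc⟩ := IsAlgClosed.exists_pow_nat_eq γ two_pos
    obtain ⟨V, hV, hzV, hVU, s, hs, hs2⟩ := hsqrt z hz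
    obtain ⟨hb0, hc0, hfr⟩ := hframe b c hb hc V hV hVU s hs hs2
    refine ⟨b, c, V, s, hb, hc, hV, hzV, hfr, ?_⟩
    rw [← hb, ← hc]
    exact det_tetradMat hb0 hc0 (hu34 z hz) (hΔ z hz) (hs2 z hzV)
  have hsymm := metric_isSymm β γ u
  refine ⟨⟨⟨fun i j z hz => ?_, fun z _ => hsymm z, fun z hz => ?_⟩,
    fun z _ v => inner2_metric_self β γ u z v,
    ⟨fun z hz => (analyticAt_const.mul (analyticAt_Delta (hu z hz))).fun_neg, fun z hz => ?_⟩,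
    fun z hz i j k l => ?_, fun z hz i j => ?_⟩, hsqrt,
    fun b c hb hc V hV hVU s hs hs2 => ?_⟩
  · obtain ⟨b, c, V, s, -, -, hV, hzV, hfr, -⟩ := hlocal z hz
    exact hfr.analyticAt_metric hV hzV i j
  · obtain ⟨b, c, V, s, -, -, hV, hzV, hfr, -⟩ := hlocal z hz
    exact (hfr.isUnit_det hzV).ne_zero
  · obtain ⟨b, c, V, s, -, -, hV, hzV, hfr, hdet⟩ := hlocal z hz
    exact hfr.sq_eq_det hzV hdet
  · obtain ⟨b, c, V, s, -, -, hV, hzV, hfr, hdet⟩ := hlocal z hz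
    exact hfr.hodgeStar_weyl hsymm hV hzV hdet i j k l
  · obtain ⟨b, c, V, s, -, -, hV, hzV, hfr, -⟩ := hlocal z hz
    exact hfr.ricci_eq_zero hsymm hV hzV i j
  · obtain ⟨hb0, hc0, hfr⟩ := hframe b c hb hc V hV hVU s hs hs2
    have han : ∀ a, AnalyticOnNhd ℂ (fun z => tetrad b c s u z a) V := fun a z hz =>
      analyticAt_tetrad hb0 hc0 (hu z (hVU hz)) (hs z hz)
        (fun h => mul_ne_zero (hu34 z (hVU hz)) (hΔ z (hVU hz)) (by rw [← hs2 z hz, h]; ring)) a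
    have hinner : ∀ z ∈ V, ∀ a d, inner2 (metric β γ u) z (tetrad b c s u z a)
        (tetrad b c s u z d) = nullGram a d := fun z hz a d => hfr.inner2_frame hz a d
    refine ⟨⟨han 0, han 1, han 2, han 3, fun z hz => ?_, fun z hz => ?_, fun z hz => ?_,
      fun z hz => ?_, fun z hz => ?_, fun z hz => ?_, fun z hz => ?_, fun z hz => ?_,
      fun z hz => ?_, fun z hz => ?_⟩, fun z hz => ?_, fun z hz i j => ?_, fun z hz v => ?_⟩
    · exact (hinner z hz 0 0).trans (by simp [nullGram])
    · exact (hinner z hz 1 1).trans (by simp [nullGram])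
    · exact (hinner z hz 2 2).trans (by simp [nullGram])
    · exact (hinner z hz 3 3).trans (by simp [nullGram])
    · exact (hinner z hz 0 1).trans (by simp [nullGram])
    · exact (hinner z hz 0 3).trans (by simp [nullGram])
    · exact (hinner z hz 2 1).trans (by simp [nullGram])
    · exact (hinner z hz 2 3).trans (by simp [nullGram])
    · exact (hinner z hz 0 2).trans (by simp [nullGram])
    · exact (hinner z hz 1 3).trans (by simp [nullGram])
    · -- `(W, W̃, Z, Z̃)` differs from the order `(W, Z, W̃, Z̃)` of the columns by a transposition
      have hperm : (Matrix.of ![fieldW b c s u z, fieldW' b c s u z, fieldZ b c s u z,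
          fieldZ' b c s u z] : Matrix (Fin 4) (Fin 4) ℂ)
          = (tetradMat b c s u z)ᵀ.submatrix (Equiv.swap 1 2) id := by
        ext i j
        fin_cases i <;> rfl
      have hsign : Equiv.Perm.sign (Equiv.swap (1 : Fin 4) 2) = -1 :=
        Equiv.Perm.sign_swap (by decide)
      have hdet := det_tetradMat hb0 hc0 (hu34 z (hVU hz)) (hΔ z (hVU hz)) (hs2 z hz)
      rw [hb, hc] at hdet
      simp only [fourForm]
      rw [hperm, Matrix.det_permute, hsign, Matrix.det_transpose]
      push_cast
      linear_combination -hdet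
    · rw [coframe_eq_mulVec, ← Matrix.one_apply, ← hfr.mul_eq_one z hz, Matrix.mul_apply]
      rfl
    · rw [← inner2_metric_self, hfr.inner2_eq hz, ← coframe_eq_mulVec]
      simp [coframe, nullGram, dotProduct, Matrix.mulVec, Fin.sum_univ_four]
      ring
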